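/- For a positive integer $d$ let $\Pi^d$ be the set of permutations of $d$ symbols, written as strings, with the Ulam metric $\Delta(x,y)=d-\mathrm{lcs}(x,y)$, where $\mathrm{lcs}(x,y)$ is the length of a longest common subsequence of $x$ and $y$. For a nonempty set $S\subseteq\Pi^d$ and $c\in\Pi^d$ let $Obj(S,c)=\sum_{s\in S}\Delta(s,c)$, and let $OPT(S)=\min_{c\in\Pi^d}Obj(S,c)$. **Lemma (A sampling lemma).** There are constants $\delta>0$, $\eta\in\mathbb N$ and a randomized algorithm ULAM1 (a single program for a word RAM with words of $O(\log d)$ bits, which can draw a uniformly random number below a given word in one step) with the following properties. Given $d\ge 1$ and any $\eta$ permutations in $\Pi^d$, ULAM1 runs in time $\tilde O(d)$, i.e. at most $A\,d\,(1+\log d)^{p}$ steps for constants $A,p$, and outputs a list of $O(\eta)$ permutations in $\Pi^d$ (the candidate centers). For every $d\ge1$ and every nonempty $S\subseteq\Pi^d$, if the input consists of $\eta$ permutations drawn independently and uniformly at random from $S$ (with replacement), then with probability at least $0.99$, over the sample and the coin tosses of ULAM1, at least one permutation $\tilde x$ in the list satisfies $$Obj(S,\tilde x)\le(2-\delta)\cdot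 OPT(S).$$ The constants $\delta,\eta,A,p$, the constants hidden in the $O(\cdot)$ and the program depend neither on $d$ nor on $S$. -/

import Mathlib

namespace UlamMedian

/-! ### The Ulam metric and the 1-median problem -/

/-- The length of a longest common subsequence of two strings. -/
noncomputable def lcsLength {α : Type*} (a b : List α) : ℕ :=
  sSup {n : ℕ | ∃ l : List α, l.Sublist a ∧ l.Sublist b ∧ l.length = n}

/-- The string of a permutation of the `d` symbols `0, …, d - 1`, in one-line notation: the symbol
at position `j` is `x j`. -/
def word {d : ℕ} (x : Equiv.Perm (Fin d)) : List (Fin d) := List.ofFn x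

/-- The Ulam distance `Δ(x, y) = d - lcs(x, y)`. A common subsequence has length at most `d`, so the
subtraction does not truncate. -/
noncomputable def ulamDist {d : ℕ} (x y : Equiv.Perm (Fin d)) : ℕ :=
  d - lcsLength (word x) (word y)

/-- The 1-median objective: the sum of the distances from the points of `S` to the center `c`. -/
noncomputable def obj {d : ℕ} (S : Finset (Equiv.Perm (Fin d))) (c : Equiv.Perm (Fin d)) : ℕ :=
  ∑ s ∈ S, ulamDist s c

/-- The optimal value: the minimum of the objective over all permutations (not only those
in `S`). -/
noncomputable def opt {d : ℕ} (S : Finset (Equiv.Perm (Fin d))) : ℕ :=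
  ⨅ c : Equiv.Perm (Fin d), obj S c

/-- `η` independent uniformly random elements of `S` (with replacement). -/
noncomputable def uniformSample {d : ℕ} (S : Finset (Equiv.Perm (Fin d))) (hS : S.Nonempty)
    (η : ℕ) : PMF (Fin η → Equiv.Perm (Fin d)) :=
  haveI : Nonempty S := hS.to_subtype
  PMF.map (fun (X : Fin η → S) (i : Fin η) => (X i).val) (PMF.uniformOfFintype (Fin η → S))

/-! ### Randomized word-RAM programs

A program is a fixed finite piece of syntax. It works on registers and on a random access memory
whose cells hold `w`-bit words; it cannot depend on the input or on its size. -/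

/-- Expressions. They occur in programs only, so each has a constant number of operations. -/
inductive Expr : Type
  | lit (n : ℕ)
  | reg (r : ℕ)
  | load (address : Expr)
  | add (a b : Expr)
  | sub (a b : Expr)
  | mul (a b : Expr)
  | div (a b : Expr)
  | mod (a b : Expr)
  | lt (a b : Expr)
  | eq (a b : Expr)

/-- Programs: assignment to a register, writing to a memory cell, drawing a uniformly random number
below a given word, and the usual structured control flow. -/
inductive Prog : Type
  | skip
  | assign (r : ℕ) (e : Expr)
  | store (address e : Expr)
  | rand (r : ℕ) (bound : Expr)
  | seq (p q : Prog)
  | ite (e : Expr) (p q : Prog)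
  | while (e : Expr) (p : Prog)

/-- Contents of the registers and of the memory. -/
structure Store where
  reg : ℕ → ℕ
  mem : ℕ → ℕ

/-- The value of an expression for word length `w`. Literals, sums and products are taken modulo
`2 ^ w`, differences are truncated at `0`, division is integer division, comparisons give `0`
or `1`. -/
def Expr.eval (w : ℕ) (s : Store) : Expr → ℕ
  | .lit n => n % 2 ^ w
  | .reg r => s.reg r
  | .load a => s.mem (a.eval w s)
  | .add a b => (a.eval w s + b.eval w s) % 2 ^ w
  | .sub a b => a.eval w s - b.eval w s
  | .mul a b => (a.eval w s * b.eval w s) % 2 ^ w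
  | .div a b => a.eval w s / b.eval w s
  | .mod a b => a.eval w s % b.eval w s
  | .lt a b => if a.eval w s < b.eval w s then 1 else 0
  | .eq a b => if a.eval w s = b.eval w s then 1 else 0

def Store.setReg (s : Store) (r v : ℕ) : Store := { s with reg := Function.update s.reg r v }

def Store.setMem (s : Store) (a v : ℕ) : Store := { s with mem := Function.update s.mem a v }

/-- A configuration: the list of programs that are still to be executed, in this order, and the
current store. The machine has halted when the list is empty. -/
structure Config where
  todo : List Prog
  store : Store

/-- A uniformly random element of `{0, …, m - 1}` (and `0` if `m = 0`). -/
noncomputable def uniformBelow (m : ℕ) : PMF ℕ :=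
  PMF.map Fin.val (PMF.uniformOfFintype (Fin (m - 1 + 1)))

/-- One time step of the machine with word length `w`, as a distribution on the next
configuration. -/
noncomputable def step (w : ℕ) : Config → PMF Config
  | ⟨[], s⟩ => PMF.pure ⟨[], s⟩
  | ⟨.skip :: k, s⟩ => PMF.pure ⟨k, s⟩
  | ⟨.assign r e :: k, s⟩ => PMF.pure ⟨k, s.setReg r (e.eval w s)⟩
  | ⟨.store a e :: k, s⟩ => PMF.pure ⟨k, s.setMem (a.eval w s) (e.eval w s)⟩
  | ⟨.rand r e :: k, s⟩ => PMF.map (fun v => ⟨k, s.setReg r v⟩) (uniformBelow (e.eval w s))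
  | ⟨.seq p q :: k, s⟩ => PMF.pure ⟨p :: q :: k, s⟩
  | ⟨.ite e p q :: k, s⟩ => PMF.pure (if e.eval w s ≠ 0 then ⟨p :: k, s⟩ else ⟨q :: k, s⟩)
  | ⟨.while e p :: k, s⟩ =>
      PMF.pure (if e.eval w s ≠ 0 then ⟨p :: .while e p :: k, s⟩ else ⟨k, s⟩)

/-- The distribution of the configuration after `t` time steps. -/
noncomputable def runSteps (w : ℕ) : ℕ → Config → PMF Config
  | 0, c => PMF.pure c
  | t + 1, c => (step w c).bind (runSteps w t)

/-- The word length for inputs over `d` symbols: `O(log d)` bits, with a constant factor `c`. -/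
def wordLength (c d : ℕ) : ℕ := c * (Nat.log 2 d + 1)

/-- The input store: register `0` holds `d`, the `η` permutations stand one after the other in the
cells `0, …, η * d - 1` in one-line notation, and everything else is `0`. -/
def inputStore {d η : ℕ} (X : Fin η → Equiv.Perm (Fin d)) : Store where
  reg r := if r = 0 then d else 0
  mem a :=
    if h : a / d < η ∧ a % d < d then (X ⟨a / d, h.1⟩ ⟨a % d, h.2⟩ : Fin d) else 0

/-- The distribution of the configuration that the program `P` has reached after `t` steps on the
input permutations `X`, with word length `wordLength c d`. -/
noncomputable def runOn {d η : ℕ} (P : Prog) (c : ℕ) (X : Fin η → Equiv.Perm (Fin d)) (t : ℕ) :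
    PMF Config :=
  runSteps (wordLength c d) t ⟨[P], inputStore X⟩

/-- The machine has halted with the list `L` of permutations as its output: register `0` holds the
length of the list, and the permutations stand one after the other in one-line notation in the
memory, from the address in register `1` on. -/
def Config.HaltsWith {d : ℕ} (f : Config) (L : List (Equiv.Perm (Fin d))) : Prop :=
  f.todo = [] ∧ f.store.reg 0 = L.length ∧
    ∀ (i : Fin L.length) (j : Fin d), f.store.mem (f.store.reg 1 + i * d + j) = (L.get i j : ℕ)

end UlamMedian

/-!
The program is deterministic: it outputs the samples together with one further permutation, the
candidate, which it computes in linear time from the first three samples.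

Fix an optimal center `x₀`, and let `I x` be the set of the symbols outside of a longest common
subsequence of `x ∈ S` and `x₀`, so that the optimal value `M` is the sum of the `#(I x)`. The
symbols outside of `I s ∪ I x` are in the same order in `s` and in `x`, so the distance of `s` and
`x` is at most `#(I s) + #(I x) - #(I s ∩ I x)`. There are two cases, and `exists_card_le_obj_le`
says what they give.

If the sum of `#(I x ∩ I y)` over all pairs exceeds `κ * #S * M`, then the average objective of the
elements of `S` is less than `(2 - κ) * M`. So a constant fraction of the elements of `S` have
objective at most `(2 - κ / 2) * M`, and it suffices to sample often enough to hit one of them.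

Otherwise two independent random sets `I x` hardly meet, and three samples `x₁`, `x₂`, `x₃` suffice
to reconstruct most of `x₀`. A stack removes inversions greedily: first those between `x₁` and `x₂`,
which leaves a string `L` (`firstKept`), then those between `L` and `x₃`, which leaves a string `L'`
(`secondKept`). The symbols outside of `L` are then inserted into `L` at the places that `x₃` gives
them relative to `L'` (`weave`). The result is the candidate.

To bound the damage, call an interval of an order dense for a set `X` if at least a fixed fraction
of its elements is in `X`, and let the dense region of `X` be the union of these intervals. By the
maximal inequality `card_denseRegion_le`, the dense region of `X` has size `O(#X)`. An element that
is wrongly kept by the stack sits in a gap between elements known to be in the right order, and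
since the removed elements of the gap come in inverted pairs, at least half of the gap has been
moved. So the gap is dense for one of the sets of moved elements, while the element that it is
compared to has been moved in another sample. This locates all errors of the candidate in the
intersection of the dense region of one of the sets `I xᵢ` with another, independent one, and in
similar sets (`agreeOff_firstBad`, `agreeOff_finalBad`). Independent random sets that hardly meet
themselves also hardly meet each other's dense regions, by the averaging argument of
`sum_sum_card_inter_le` and by `denseRegion_inter_subset`. Hence the candidate has on average at
most `M / (200 * #S)` bad symbols (`sum_card_finalBad_le`). By Markov's inequality it has at most
`M / (2 * #S)` bad symbols with probability `0.99`, and then its objective is at most `1.5 * M`.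

The running time and the correctness of the program are derived in a small calculus of total
correctness for deterministic programs with time bounds (`Tot`).
-/

namespace UlamMedian

/-! ### Dense regions -/

open Finset

section Regions

variable {V β γ : Type*} [DecidableEq V] [LinearOrder β] [LinearOrder γ]

/-- `H` is convex in the ground set `G`, for the order given by the ranks `p`. -/
def IsConvexIn (G : Finset V) (p : V → β) (H : Finset V) : Prop :=
  H ⊆ G ∧ ∀ x ∈ H, ∀ z ∈ H, ∀ y ∈ G, p x ≤ p y → p y ≤ p z → y ∈ H

open Classical in
/-- The part of `G` that is covered by intervals (in the order given by the ranks `p`) in which the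
set `X` has density at least `1 / N`: a superlevel set of the maximal function of `X`. -/
noncomputable def denseRegion (G : Finset V) (p : V → β) (N : ℕ) (X : Finset V) : Finset V :=
  G.filter fun u => ∃ H, IsConvexIn G p H ∧ u ∈ H ∧ #H ≤ N * #(H ∩ X)

theorem mem_denseRegion {G X : Finset V} {p : V → β} {N : ℕ} {u : V} :
    u ∈ denseRegion G p N X ↔
      u ∈ G ∧ ∃ H, IsConvexIn G p H ∧ u ∈ H ∧ #H ≤ N * #(H ∩ X) := by
  simp [denseRegion]

theorem IsConvexIn.subset_denseRegion {G H X : Finset V} {p : V → β} {N : ℕ}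
    (hH : IsConvexIn G p H) (h : #H ≤ N * #(H ∩ X)) : H ⊆ denseRegion G p N X := by
  intro u hu
  rw [mem_denseRegion]
  exact ⟨hH.1 hu, H, hH, hu, h⟩

theorem subset_denseRegion_self {G X : Finset V} {p : V → β} {N : ℕ} (hX : X ⊆ G)
    (hp : Function.Injective p) (hN : 1 ≤ N) : X ⊆ denseRegion G p N X := by
  intro u hu
  have : IsConvexIn G p {u} := by
    refine ⟨singleton_subset_iff.2 (hX hu), fun x hx z hz y _ hxy hyz => ?_⟩
    rw [mem_singleton] at hx hz ⊢
    subst hx; subst hz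
    exact hp (le_antisymm hyz hxy)
  exact this.subset_denseRegion (by simpa [hu] using hN) (mem_singleton_self u)

theorem IsConvexIn.union {G H H' : Finset V} {p : V → β} {u : V} (hH : IsConvexIn G p H)
    (hH' : IsConvexIn G p H') (hu : u ∈ H) (hu' : u ∈ H') : IsConvexIn G p (H ∪ H') := by
  refine ⟨union_subset hH.1 hH'.1, fun x hx z hz y hy hxy hyz => ?_⟩
  rw [mem_union] at hx hz ⊢
  rcases le_total (p y) (p u) with hyu | hyu
  · rcases hx with hx | hx
    · exact Or.inl (hH.2 x hx u hu y hy hxy hyu)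
    · exact Or.inr (hH'.2 x hx u hu' y hy hxy hyu)
  · rcases hz with hz | hz
    · exact Or.inl (hH.2 u hu z hz y hy hyu hyz)
    · exact Or.inr (hH'.2 u hu' z hz y hy hyu hyz)

/-- The one-sided maximal inequality: intervals that end in the points that they serve can be
chosen disjoint, greedily from the top. -/
theorem card_le_of_forall_isConvexIn_le (p : V → β) (N : ℕ) (X : Finset V) :
    ∀ (n : ℕ) (G R : Finset V), #R ≤ n → R ⊆ G →
      (∀ u ∈ R, ∃ H, IsConvexIn G p H ∧ u ∈ H ∧ (∀ v ∈ H, p v ≤ p u) ∧ #H ≤ N * #(H ∩ X)) →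
      #R ≤ N * #(G ∩ X) := by
  intro n
  induction n with
  | zero => intro G R hR _ _; omega
  | succ n ih =>
    intro G R hR hRG h
    rcases R.eq_empty_or_nonempty with rfl | hne
    · simp
    obtain ⟨u, huR, humax⟩ := R.exists_max_image p hne
    obtain ⟨H, hH, huH, hle, hcard⟩ := h u huR
    set G' := G.filter fun v => ∀ x ∈ H, p v < p x with hG'
    have hlow : ∀ v ∈ R \ H, ∀ x ∈ H, p v < p x := by
      intro v hv x hx
      rw [mem_sdiff] at hv
      by_contra hlt
      exact hv.2 (hH.2 x hx u huH v (hRG hv.1) (not_lt.1 hlt) (humax v hv.1))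
    have h1 : #(R \ H) ≤ N * #(G' ∩ X) := by
      apply ih
      · have : #(R \ H) < #R := card_lt_card
          ⟨sdiff_subset, fun hsub => (mem_sdiff.1 (hsub huR)).2 huH⟩
        omega
      · intro v hv
        exact mem_filter.2 ⟨hRG (mem_sdiff.1 hv).1, hlow v hv⟩
      · intro v hv
        obtain ⟨K, hK, hvK, hKle, hKc⟩ := h v (mem_sdiff.1 hv).1
        have hKG' : K ⊆ G' := fun z hz =>
          mem_filter.2 ⟨hK.1 hz, fun x hx => (hKle z hz).trans_lt (hlow v hv x hx)⟩
        exact ⟨K, ⟨hKG', fun x hx z hz y hy => hK.2 x hx z hz y (mem_filter.1 hy).1⟩,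
          hvK, hKle, hKc⟩
    have hdisj : Disjoint (H ∩ X) (G' ∩ X) := by
      rw [disjoint_left]
      intro v hv hv'
      exact lt_irrefl _ ((mem_filter.1 (mem_inter.1 hv').1).2 v (mem_inter.1 hv).1)
    have h2 : #(H ∩ X) + #(G' ∩ X) ≤ #(G ∩ X) := by
      rw [← card_union_of_disjoint hdisj]
      exact card_le_card (union_subset (inter_subset_inter_right hH.1)
        (inter_subset_inter_right (filter_subset _ _)))
    calc #R ≤ #(H ∪ (R \ H)) := card_le_card (by
          intro v hv; by_cases hvH : v ∈ H <;> simp [hv, hvH])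
      _ ≤ #H + #(R \ H) := card_union_le _ _
      _ ≤ N * #(H ∩ X) + N * #(G' ∩ X) := by omega
      _ = N * (#(H ∩ X) + #(G' ∩ X)) := by ring
      _ ≤ _ := Nat.mul_le_mul_left _ h2

/-- The maximal inequality for intervals. -/
theorem card_denseRegion_le (G : Finset V) {p : V → β} (hp : Function.Injective p) (N : ℕ)
    (X : Finset V) : #(denseRegion G p N X) ≤ 2 * N * #X := by
  classical
  set R₁ := G.filter fun u =>
    ∃ H, IsConvexIn G p H ∧ u ∈ H ∧ (∀ v ∈ H, p v ≤ p u) ∧ #H ≤ N * #(H ∩ X) with hR₁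
  set R₂ := G.filter fun u =>
    ∃ H, IsConvexIn G p H ∧ u ∈ H ∧ (∀ v ∈ H, p u ≤ p v) ∧ #H ≤ N * #(H ∩ X) with hR₂
  have hsub : denseRegion G p N X ⊆ R₁ ∪ R₂ := by
    intro u hu
    rw [mem_denseRegion] at hu
    obtain ⟨huG, H, hH, huH, hc⟩ := hu
    -- One of the two halves of a dense interval, cut at `u`, is dense.
    set Hl := H.filter fun v => p v ≤ p u with hHl
    set Hr := H.filter fun v => ¬ p v ≤ p u with hHr
    have e1 : #Hl + #Hr = #H := card_filter_add_card_filter_not _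
    have e2 : #(Hl ∩ X) + #(Hr ∩ X) = #(H ∩ X) := by
      rw [hHl, hHr, filter_inter, filter_inter]
      exact card_filter_add_card_filter_not _
    rw [mem_union]
    by_cases hl : #Hl ≤ N * #(Hl ∩ X)
    · left
      refine mem_filter.2 ⟨huG, Hl, ⟨(filter_subset _ _).trans hH.1, ?_⟩,
        mem_filter.2 ⟨huH, le_rfl⟩, fun v hv => (mem_filter.1 hv).2, hl⟩
      intro x hx z hz y hy hxy hyz
      exact mem_filter.2 ⟨hH.2 x (mem_filter.1 hx).1 z (mem_filter.1 hz).1 y hy hxy hyz,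
        hyz.trans (mem_filter.1 hz).2⟩
    · right
      set Hg := H.filter fun v => p u ≤ p v with hHg
      refine mem_filter.2 ⟨huG, Hg, ⟨(filter_subset _ _).trans hH.1, ?_⟩,
        mem_filter.2 ⟨huH, le_rfl⟩, fun v hv => (mem_filter.1 hv).2, ?_⟩
      · intro x hx z hz y hy hxy hyz
        exact mem_filter.2 ⟨hH.2 x (mem_filter.1 hx).1 z (mem_filter.1 hz).1 y hy hxy hyz,
          (mem_filter.1 hx).2.trans hxy⟩
      · have e3 : Hg = insert u Hr := by
          ext v
          simp only [hHg, hHr, mem_filter, mem_insert, not_le]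
          constructor
          · rintro ⟨hv, hle⟩
            rcases hle.eq_or_lt with h | h
            · exact Or.inl (hp h.symm)
            · exact Or.inr ⟨hv, h⟩
          · rintro (rfl | ⟨hv, hlt⟩)
            · exact ⟨huH, le_rfl⟩
            · exact ⟨hv, hlt.le⟩
        have e4 : #Hg ≤ #Hr + 1 := by rw [e3]; exact card_insert_le _ _
        have e5 : #(Hr ∩ X) ≤ #(Hg ∩ X) := by
          rw [e3]; exact card_le_card (inter_subset_inter_right (subset_insert _ _))
        have e6 := Nat.mul_le_mul_left N e5
        rw [← e2, mul_add] at hc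
        omega
  have h1 : #R₁ ≤ N * #(G ∩ X) :=
    card_le_of_forall_isConvexIn_le p N X _ G R₁ le_rfl (filter_subset _ _)
      fun u hu => (mem_filter.1 hu).2
  have h2 : #R₂ ≤ N * #(G ∩ X) := by
    refine card_le_of_forall_isConvexIn_le (fun v => OrderDual.toDual (p v)) N X _ G R₂ le_rfl
      (filter_subset _ _) fun u hu => ?_
    obtain ⟨H, hH, huH, hle, hc⟩ := (mem_filter.1 hu).2
    exact ⟨H, ⟨hH.1, fun x hx z hz y hy hxy hyz => hH.2 z hz x hx y hy hyz hxy⟩, huH, hle, hc⟩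
  have h3 : #(G ∩ X) ≤ #X := card_le_card inter_subset_right
  calc #(denseRegion G p N X) ≤ #(R₁ ∪ R₂) := card_le_card hsub
    _ ≤ #R₁ + #R₂ := card_union_le _ _
    _ ≤ 2 * N * #(G ∩ X) := by linarith
    _ ≤ _ := Nat.mul_le_mul_left _ h3

/-- Of two intersecting dense intervals, the longer one makes the shorter one part of a dense
interval; so two dense regions meet only where one of the sets is dense inside the dense region
of the other. -/
theorem denseRegion_inter_subset (G : Finset V) (p : V → β) (N : ℕ) (X Y : Finset V) :
    denseRegion G p N X ∩ denseRegion G p N Y ⊆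
      denseRegion G p N (X ∩ denseRegion G p (2 * N) Y) ∪
        denseRegion G p N (Y ∩ denseRegion G p (2 * N) X) := by
  have key : ∀ (X Y H H' : Finset V) (u : V), IsConvexIn G p H → u ∈ H → #H ≤ N * #(H ∩ X) →
      IsConvexIn G p H' → u ∈ H' → #H' ≤ N * #(H' ∩ Y) → #H ≤ #H' →
      u ∈ denseRegion G p N (X ∩ denseRegion G p (2 * N) Y) := by
    intro X Y H H' u hH hu hc hH' hu' hc' hle
    have hsub : H ∪ H' ⊆ denseRegion G p (2 * N) Y := by
      apply (hH.union hH' hu hu').subset_denseRegion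
      have h1 := card_union_le H H'
      have h2 : #(H' ∩ Y) ≤ #((H ∪ H') ∩ Y) :=
        card_le_card (inter_subset_inter_right subset_union_right)
      have h3 := Nat.mul_le_mul_left N h2
      linarith
    have heq : H ∩ (X ∩ denseRegion G p (2 * N) Y) = H ∩ X := by
      rw [inter_comm X, ← inter_assoc, inter_eq_left.2 (subset_union_left.trans hsub)]
    exact hH.subset_denseRegion (by rwa [heq]) hu
  intro u hu
  rw [mem_inter, mem_denseRegion, mem_denseRegion] at hu
  obtain ⟨⟨-, H, hH, huH, hc⟩, -, H', hH', huH', hc'⟩ := hu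
  rw [mem_union]
  rcases le_total (#H) (#H') with hle | hle
  · exact Or.inl (key X Y H H' u hH huH hc hH' huH' hc' hle)
  · exact Or.inr (key Y X H' H u hH' huH' hc' hH huH hc hle)

end Regions

/-! ### Pairs of inverted elements -/

section Pairing

variable {V : Type*} [DecidableEq V]

/-- `I` contains a member of every pair of elements of `G` that `p` and `q` order differently. -/
def AgreeOff (G I : Finset V) (p q : V → ℕ) : Prop :=
  ∀ u ∈ G, ∀ v ∈ G, u ∉ I → v ∉ I → (p u < p v ↔ q u < q v)

/-- What the greedy removal of inversions leaves behind: `L ⊆ G` is the set of the kept elements,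
on which the orders given by `p` and `q` agree, and the removed elements are matched by `π` into
inverted pairs, no one of which encloses a kept element in the order given by `p`. -/
structure StackPairing (G L : Finset V) (p q : V → ℕ) (π : V → V) : Prop where
  subset : L ⊆ G
  mono : ∀ u ∈ L, ∀ v ∈ L, p u < p v → q u < q v
  maps : ∀ u ∈ G, u ∉ L → π u ∈ G ∧ π u ∉ L
  invol : ∀ u ∈ G, u ∉ L → π (π u) = u
  inverted : ∀ u ∈ G, u ∉ L → (p u < p (π u) ∧ q (π u) < q u ∨ p (π u) < p u ∧ q u < q (π u))
  separated : ∀ u ∈ G, u ∉ L → ∀ c ∈ L, (p c < p u ↔ p c < p (π u))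

/-- A set that is closed under the matching, and whose kept elements lie in `I`, is at least half
filled by `I`. -/
theorem StackPairing.card_le {G L I K : Finset V} {p q : V → ℕ} {π : V → V}
    (h : StackPairing G L p q π) (hI : AgreeOff G I p q) (hK : K ⊆ G)
    (hKL : ∀ u ∈ K, u ∈ L → u ∈ I) (hπ : ∀ u ∈ K, u ∉ L → π u ∈ K) :
    #K ≤ 2 * #(K ∩ I) := by
  have hmem : ∀ u ∈ K \ I, u ∈ G ∧ u ∉ L := by
    intro u hu
    rw [mem_sdiff] at hu
    exact ⟨hK hu.1, fun hL => hu.2 (hKL u hu.1 hL)⟩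
  have h1 : #(K \ I) ≤ #(K ∩ I) := by
    apply card_le_card_of_injOn π
    · intro u hu
      obtain ⟨huG, huL⟩ := hmem u hu
      have hu' := mem_sdiff.1 hu
      rw [mem_coe, mem_inter]
      refine ⟨hπ u hu'.1 huL, ?_⟩
      by_contra hn
      have := hI u huG (π u) (h.maps u huG huL).1 hu'.2 hn
      rcases h.inverted u huG huL with h' | h' <;> omega
    · intro u hu v hv huv
      obtain ⟨huG, huL⟩ := hmem u hu
      obtain ⟨hvG, hvL⟩ := hmem v hv
      rw [← h.invol u huG huL, ← h.invol v hvG hvL, huv]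
  have h2 := card_sdiff_add_card_inter K I
  omega

/-- The elements outside `Cl` that lie in the same gap of `Cl` as `e`, for the order given by
`p`. -/
def cell (G Cl : Finset V) (p : V → ℕ) (e : V) : Finset V :=
  G.filter fun k => k ∉ Cl ∧ ∀ c ∈ Cl, (p c < p k ↔ p c < p e)

theorem mem_cell {G Cl : Finset V} {p : V → ℕ} {e k : V} :
    k ∈ cell G Cl p e ↔ k ∈ G ∧ k ∉ Cl ∧ ∀ c ∈ Cl, (p c < p k ↔ p c < p e) := by
  simp [cell]

theorem isConvexIn_cell (G Cl : Finset V) {p : V → ℕ} (hp : Function.Injective p) (e : V) :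
    IsConvexIn G p (cell G Cl p e) := by
  refine ⟨filter_subset _ _, fun x hx z hz y hy hxy hyz => ?_⟩
  rw [mem_cell] at hx hz ⊢
  have hne : ∀ k, k ∉ Cl → y ∈ Cl → p k ≠ p y := fun k hk hy' he => hk (hp he ▸ hy')
  refine ⟨hy, fun hyC => ?_, fun c hc => ?_⟩
  · have h1 := hne x hx.2.1 hyC
    have h2 := hne z hz.2.1 hyC
    have h3 := hx.2.2 y hyC
    have h4 := hz.2.2 y hyC
    omega
  · have h3 := hx.2.2 c hc
    have h4 := hz.2.2 c hc
    omega

/-- A cell of kept elements that contains all kept elements outside `I` is half filled by `I`. -/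
theorem StackPairing.card_cell_le {G L I Cl : Finset V} {p q : V → ℕ} {π : V → V}
    (h : StackPairing G L p q π) (hI : AgreeOff G I p q) (hCl : Cl ⊆ L)
    (hL : ∀ u ∈ L, u ∉ Cl → u ∈ I) (e : V) :
    #(cell G Cl p e) ≤ 2 * #(cell G Cl p e ∩ I) := by
  refine h.card_le hI (filter_subset _ _) (fun u hu huL => hL u huL (mem_cell.1 hu).2.1) ?_
  intro u hu huL
  rw [mem_cell] at hu ⊢
  have hm := h.maps u hu.1 huL
  exact ⟨hm.1, fun hc => hm.2 (hCl hc), fun c hc =>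
    (h.separated u hu.1 huL c (hCl hc)).symm.trans (hu.2.2 c hc)⟩

end Pairing
end UlamMedian

namespace UlamMedian

/-! ### Symbols on which the candidate may go wrong -/

open Finset

section Bad

variable {V : Type*} [DecidableEq V] [Fintype V]

/-- The elements that may be out of order after the first round of the greedy removal, when `p₀`
is the hidden order, `p₁` and `p₂` are two samples, and `I₁` and `I₂` are the elements that they
have moved. -/
noncomputable def firstBad (p₀ p₁ : V → ℕ) (I₁ I₂ : Finset V) : Finset V :=
  I₁ ∩ I₂ ∪ I₂ ∩ denseRegion univ p₁ 4 I₁ ∪ I₂ ∩ denseRegion univ p₀ 2 I₁ ∪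
    I₁ ∩ denseRegion univ p₀ 8 I₂

/-- Let `e` be moved only in `p₁` and `g` only in `p₂`, and let `e` be kept. If `p₀` and `p₁` order
`e` and `g` differently, then no element that is kept and unmoved lies between them in either of
these orders. So both lie in the same cell `K` for `p₁`, and in the same cell `H` for `p₀`, which
agrees with `K` up to `I₁`. As `K` is half filled by `I₁ ∪ I₂`, the set `I₁` is dense in `K`
or in `H`, or else `I₂` is dense in `H`. -/
theorem mem_firstBad_of_disagree {p₀ p₁ p₂ : V → ℕ} {I₁ I₂ L : Finset V} {π : V → V}
    (h0 : Function.Injective p₀) (h1 : Function.Injective p₁) (h2 : Function.Injective p₂)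
    (hI₁ : AgreeOff univ I₁ p₀ p₁) (hI₂ : AgreeOff univ I₂ p₀ p₂)
    (hL : StackPairing univ L p₁ p₂ π) {e g : V} (he : e ∈ L)
    (he1 : e ∈ I₁) (he2 : e ∉ I₂) (hg1 : g ∉ I₁) (hg2 : g ∈ I₂)
    (hne : ¬ (p₀ g < p₀ e ↔ p₁ g < p₁ e)) :
    e ∈ firstBad p₀ p₁ I₁ I₂ ∨ g ∈ firstBad p₀ p₁ I₁ I₂ := by
  set Cl := L \ (I₁ ∪ I₂) with hCl
  have hClL : Cl ⊆ L := sdiff_subset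
  have hcl : ∀ c ∈ Cl, c ∈ L ∧ c ∉ I₁ ∧ c ∉ I₂ := by
    intro c hc
    simpa [hCl] using hc
  have hiff : ∀ u ∈ L, ∀ v ∈ L, (p₁ u < p₁ v ↔ p₂ u < p₂ v) := by
    intro u hu v hv
    have a := hL.mono u hu v hv
    have b := hL.mono v hv u hu
    rcases eq_or_ne u v with rfl | huv
    · simp
    have c := h1.ne huv
    have d := h2.ne huv
    omega
  have hce : ∀ c ∈ Cl, (p₁ c < p₁ e ↔ p₀ c < p₀ e) := fun c hc =>
    (hiff c (hClL hc) e he).trans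
      (hI₂ c (mem_univ _) e (mem_univ _) (hcl c hc).2.2 he2).symm
  have hck : ∀ c ∈ Cl, ∀ k, k ∉ I₁ → (p₁ c < p₁ k ↔ p₀ c < p₀ k) := fun c hc k hk =>
    (hI₁ c (mem_univ _) k (mem_univ _) (hcl c hc).2.1 hk).symm
  have hneC : ∀ c ∈ Cl, c ≠ e ∧ c ≠ g := fun c hc =>
    ⟨fun h => (hcl c hc).2.1 (h ▸ he1), fun h => (hcl c hc).2.2 (h ▸ hg2)⟩
  have hcg : ∀ c ∈ Cl, (p₁ c < p₁ g ↔ p₁ c < p₁ e) := by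
    intro c hc
    have a := hce c hc
    have b := hck c hc g hg1
    have a1 := h1.ne (hneC c hc).1
    have a2 := h1.ne (hneC c hc).2
    have a3 := h0.ne (hneC c hc).1
    have a4 := h0.ne (hneC c hc).2
    omega
  set K := cell univ Cl p₁ e with hK
  set H := cell univ Cl p₀ e with hH
  have hKc : IsConvexIn univ p₁ K := isConvexIn_cell _ _ h1 e
  have hHc : IsConvexIn univ p₀ H := isConvexIn_cell _ _ h0 e
  have hgK : g ∈ K := mem_cell.2 ⟨mem_univ _, fun h => (hcl g h).2.2 hg2, hcg⟩
  have heH : e ∈ H := mem_cell.2 ⟨mem_univ _, fun h => (hcl e h).2.1 he1, fun c _ => Iff.rfl⟩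
  have hgH : g ∈ H := mem_cell.2 ⟨mem_univ _, fun h => (hcl g h).2.2 hg2, fun c hc =>
    (hck c hc g hg1).symm.trans ((hcg c hc).trans (hce c hc))⟩
  have hHK : H \ I₁ = K \ I₁ := by
    ext k
    simp only [mem_sdiff, hH, hK, mem_cell]
    constructor
    · rintro ⟨⟨a, b, c⟩, d⟩
      exact ⟨⟨a, b, fun x hx => (hck x hx k d).trans ((c x hx).trans (hce x hx).symm)⟩, d⟩
    · rintro ⟨⟨a, b, c⟩, d⟩
      exact ⟨⟨a, b, fun x hx => (hck x hx k d).symm.trans ((c x hx).trans (hce x hx))⟩, d⟩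
  have hI : AgreeOff univ (I₁ ∪ I₂) p₁ p₂ := by
    intro u _ v _ hu hv
    rw [mem_union, not_or] at hu hv
    exact (hI₁ u (mem_univ _) v (mem_univ _) hu.1 hv.1).symm.trans
      (hI₂ u (mem_univ _) v (mem_univ _) hu.2 hv.2)
  have hcard : #K ≤ 2 * #(K ∩ (I₁ ∪ I₂)) := by
    refine hL.card_cell_le hI hClL (fun u hu hu' => ?_) e
    by_contra hn
    exact hu' (mem_sdiff.2 ⟨hu, hn⟩)
  have hsplit : #(K ∩ (I₁ ∪ I₂)) ≤ #(K ∩ I₁) + #((K \ I₁) ∩ I₂) := by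
    refine (card_le_card ?_).trans (card_union_le _ _)
    intro v hv
    rw [mem_inter, mem_union] at hv
    rw [mem_union, mem_inter, mem_inter, mem_sdiff]
    by_cases hv1 : v ∈ I₁
    · exact Or.inl ⟨hv.1, hv1⟩
    · exact Or.inr ⟨⟨hv.1, hv1⟩, hv.2.resolve_left hv1⟩
  simp only [firstBad, mem_union, mem_inter]
  by_cases hA : #K ≤ 4 * #(K ∩ I₁)
  · exact Or.inr (Or.inl (Or.inl (Or.inr ⟨hg2, hKc.subset_denseRegion hA hgK⟩)))
  have hHsplit : #(K \ I₁) + #(H ∩ I₁) = #H := by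
    rw [← hHK]; exact card_sdiff_add_card_inter H I₁
  by_cases hB : #H ≤ 2 * #(H ∩ I₁)
  · exact Or.inr (Or.inl (Or.inr ⟨hg2, hHc.subset_denseRegion hB hgH⟩))
  have hle : #(K \ I₁) ≤ #K := card_le_card sdiff_subset
  have hle2 : #((K \ I₁) ∩ I₂) ≤ #(H ∩ I₂) := by
    rw [← hHK]; exact card_le_card (inter_subset_inter_right sdiff_subset)
  -- `#K ≤ 2 #(K ∩ I₁) + 2 #(H ∩ I₂) < #K / 2 + 2 #(H ∩ I₂)` and `#H < 2 #K`, so `#H < 8 #(H ∩ I₂)`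
  exact Or.inl (Or.inr ⟨he1, hHc.subset_denseRegion (by omega) heH⟩)

/-- The greedy removal of the inversions between two samples leaves a string that is in the hidden
order off `firstBad`. An inverted pair that survives has the hidden order neither in `p₁` nor in
`p₂`, so that one of its elements is moved in `p₁` and the other one in `p₂`. -/
theorem agreeOff_firstBad {p₀ p₁ p₂ : V → ℕ} {I₁ I₂ L : Finset V} {π : V → V}
    (h0 : Function.Injective p₀) (h1 : Function.Injective p₁) (h2 : Function.Injective p₂)
    (hI₁ : AgreeOff univ I₁ p₀ p₁) (hI₂ : AgreeOff univ I₂ p₀ p₂)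
    (hL : StackPairing univ L p₁ p₂ π) :
    AgreeOff L (firstBad p₀ p₁ I₁ I₂) p₀ p₁ := by
  intro u hu v hv hu' hv'
  by_contra hne
  have hnu : ¬ (u ∈ I₁ ∧ u ∈ I₂) := fun h => hu' (by simp [firstBad, h.1, h.2])
  have hnv : ¬ (v ∈ I₁ ∧ v ∈ I₂) := fun h => hv' (by simp [firstBad, h.1, h.2])
  have huv : u ≠ v := by
    rintro rfl
    simp at hne
  have d0 := h0.ne huv
  have d1 := h1.ne huv
  have d2 := h2.ne huv
  have m1 := hL.mono u hu v hv
  have m2 := hL.mono v hv u hu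
  have a1 := hI₁ u (mem_univ _) v (mem_univ _)
  have a2 := hI₂ u (mem_univ _) v (mem_univ _)
  have hc1 : u ∈ I₁ ∨ v ∈ I₁ := by
    by_contra hn
    rw [not_or] at hn
    exact hne (a1 hn.1 hn.2)
  have hc2 : u ∈ I₂ ∨ v ∈ I₂ := by
    by_contra hn
    rw [not_or] at hn
    have := a2 hn.1 hn.2
    omega
  rcases hc1 with hu1 | hv1
  · have hu2 : u ∉ I₂ := fun h => hnu ⟨hu1, h⟩
    have hv2 : v ∈ I₂ := hc2.resolve_left hu2
    have hv1 : v ∉ I₁ := fun h => hnv ⟨h, hv2⟩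
    rcases mem_firstBad_of_disagree h0 h1 h2 hI₁ hI₂ hL hu hu1 hu2 hv1 hv2 (by omega)
      with h | h
    · exact hu' h
    · exact hv' h
  · have hv2 : v ∉ I₂ := fun h => hnv ⟨hv1, h⟩
    have hu2 : u ∈ I₂ := hc2.resolve_right hv2
    have hu1 : u ∉ I₁ := fun h => hnu ⟨h, hu2⟩
    rcases mem_firstBad_of_disagree h0 h1 h2 hI₁ hI₂ hL hv hv1 hv2 hu1 hu2 (by omega)
      with h | h
    · exact hv' h
    · exact hu' h

/-- The elements that may be out of order in the output: `A` is the exceptional set of the first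
round, `L` the set that it keeps, and `I₃` the set of the elements moved in the third sample. -/
noncomputable def finalBad (p₀ p₁ : V → ℕ) (L A I₃ : Finset V) : Finset V :=
  A ∪ denseRegion L p₁ 8 A ∪ denseRegion univ p₀ 8 A ∪
    (univ \ L) ∩ denseRegion univ p₀ 11 I₃ ∪
    denseRegion L p₁ 4 (I₃ ∩ denseRegion univ p₀ 2 (univ \ L))

/-- An element `w` outside `L`, placed by the third sample, against an element `e` of `L`. If they
are out of order, they lie in the same gap of the clean elements (those kept in both rounds, not in
`A`, and not moved in `p₃`). The cell `K` of this gap in `L` is half filled by `I₃ ∪ A`, hence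
mostly by `I₃`, and the cell `H` in the order given by `p₀` consists of `K`, of elements of `A`, and
of removed elements; so the removed elements or the elements of `I₃` are dense in `H`. -/
theorem lt_iff_lt_of_notMem_finalBad {p₀ p₁ p₃ py : V → ℕ} {L L' A I₃ : Finset V} {π : V → V}
    (h0 : Function.Injective p₀) (h1 : Function.Injective p₁) (hy : Function.Injective py)
    (hA : AgreeOff L A p₀ p₁) (hI₃ : AgreeOff univ I₃ p₀ p₃)
    (hL' : StackPairing L L' p₁ p₃ π)
    (hyL : AgreeOff L ∅ py p₁) (hyU : AgreeOff (univ \ (L \ L')) ∅ py p₃)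
    {w e : V} (hw : w ∉ L) (he : e ∈ L)
    (hwb : w ∉ finalBad p₀ p₁ L A I₃) (heb : e ∉ finalBad p₀ p₁ L A I₃) :
    p₀ w < p₀ e ↔ py w < py e := by
  simp only [finalBad, mem_union, mem_inter, mem_sdiff, mem_univ, true_and, not_or, not_and]
    at hwb heb
  have hI₃R : I₃ ⊆ denseRegion univ p₀ 11 I₃ :=
    subset_denseRegion_self (subset_univ _) h0 (by norm_num)
  have hwI : w ∉ I₃ := fun h => hwb.1.2 hw (hI₃R h)
  have heA : e ∉ A := heb.1.1.1.1
  set Cl := L' \ (I₃ ∪ A) with hCl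
  have hcl : ∀ c ∈ Cl, c ∈ L' ∧ c ∉ I₃ ∧ c ∉ A := by
    intro c hc
    simpa [hCl] using hc
  have hClL : ∀ c ∈ Cl, c ∈ L := fun c hc => hL'.subset (hcl c hc).1
  have hcw : ∀ c ∈ Cl, (py c < py w ↔ p₀ c < p₀ w) ∧ (py w < py c ↔ p₀ w < p₀ c) := by
    intro c hc
    have hcU : c ∈ univ \ (L \ L') := by simp [(hcl c hc).1]
    have hwU : w ∈ univ \ (L \ L') := by simp [hw]
    constructor
    · exact (hyU c hcU w hwU (notMem_empty _) (notMem_empty _)).trans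
        (hI₃ c (mem_univ _) w (mem_univ _) (hcl c hc).2.1 hwI).symm
    · exact (hyU w hwU c hcU (notMem_empty _) (notMem_empty _)).trans
        (hI₃ w (mem_univ _) c (mem_univ _) hwI (hcl c hc).2.1).symm
  have hck : ∀ c ∈ Cl, ∀ k ∈ L, k ∉ A → (p₁ c < p₁ k ↔ p₀ c < p₀ k) := fun c hc k hk hkA =>
    (hA c (hClL c hc) k hk (hcl c hc).2.2 hkA).symm
  have hce : ∀ c ∈ Cl, (py c < py e ↔ p₀ c < p₀ e) := fun c hc =>
    (hyL c (hClL c hc) e he (notMem_empty _) (notMem_empty _)).trans (hck c hc e he heA)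
  by_cases heC : e ∈ Cl
  · exact (hcw e heC).2.symm
  by_contra hne
  have hneC : ∀ c ∈ Cl, c ≠ e ∧ c ≠ w := fun c hc =>
    ⟨fun h => heC (h ▸ hc), fun h => hw (h ▸ hClL c hc)⟩
  have hwe : w ≠ e := fun h => hw (h ▸ he)
  have hwH' : ∀ c ∈ Cl, (p₀ c < p₀ w ↔ p₀ c < p₀ e) := by
    intro c hc
    have a := hce c hc
    have b := hcw c hc
    have a1 := hy.ne (hneC c hc).1
    have a2 := hy.ne (hneC c hc).2
    have a3 := h0.ne (hneC c hc).1
    have a4 := h0.ne (hneC c hc).2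
    have a5 := h0.ne hwe
    have a6 := hy.ne hwe
    omega
  set K := cell L Cl p₁ e with hK
  set H := cell univ Cl p₀ e with hH
  have hKc : IsConvexIn L p₁ K := isConvexIn_cell _ _ h1 e
  have hHc : IsConvexIn univ p₀ H := isConvexIn_cell _ _ h0 e
  have heK : e ∈ K := mem_cell.2 ⟨he, heC, fun c _ => Iff.rfl⟩
  have heH : e ∈ H := mem_cell.2 ⟨mem_univ _, heC, fun c _ => Iff.rfl⟩
  have hwH : w ∈ H := mem_cell.2 ⟨mem_univ _, fun h => hw (hClL w h), hwH'⟩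
  have hI : AgreeOff L (I₃ ∪ A) p₁ p₃ := by
    intro u hu v hv hu' hv'
    rw [mem_union, not_or] at hu' hv'
    exact (hA u hu v hv hu'.2 hv'.2).symm.trans
      (hI₃ u (mem_univ _) v (mem_univ _) hu'.1 hv'.1)
  have hcard : #K ≤ 2 * #(K ∩ (I₃ ∪ A)) := by
    refine hL'.card_cell_le hI sdiff_subset (fun u hu hu' => ?_) e
    by_contra hn
    exact hu' (mem_sdiff.2 ⟨hu, hn⟩)
  have hsplit : #(K ∩ (I₃ ∪ A)) ≤ #((K \ A) ∩ I₃) + #(K ∩ A) := by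
    refine (card_le_card ?_).trans (card_union_le _ _)
    intro v hv
    rw [mem_inter, mem_union] at hv
    rw [mem_union, mem_inter, mem_inter, mem_sdiff]
    by_cases hvA : v ∈ A
    · exact Or.inr ⟨hv.1, hvA⟩
    · exact Or.inl ⟨⟨hv.1, hvA⟩, hv.2.resolve_right hvA⟩
  have hKA : 8 * #(K ∩ A) < #K := by
    by_contra hn
    exact heb.1.1.1.2 (hKc.subset_denseRegion (not_lt.1 hn) heK)
  have hHA : 8 * #(H ∩ A) < #H := by
    by_contra hn
    exact heb.1.1.2 (hHc.subset_denseRegion (not_lt.1 hn) heH)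
  have hKH : ∀ k ∈ L, k ∉ A → (k ∈ K ↔ k ∈ H) := by
    intro k hk hkA
    simp only [hK, hH, mem_cell, hk, mem_univ, true_and]
    refine and_congr_right fun _ => forall₂_congr fun c hc => ?_
    rw [hck c hc k hk hkA, hck c hc e he heA]
  have hHsplit : #H ≤ #K + #(H ∩ A) + #(H ∩ (univ \ L)) := by
    refine (card_le_card (t := K ∪ H ∩ A ∪ H ∩ (univ \ L)) ?_).trans
      ((card_union_le _ _).trans (Nat.add_le_add_right (card_union_le _ _) _))
    intro k hk
    simp only [mem_union, mem_inter, mem_sdiff, mem_univ, true_and]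
    by_cases hkL : k ∈ L
    · by_cases hkA : k ∈ A
      · exact Or.inl (Or.inr ⟨hk, hkA⟩)
      · exact Or.inl (Or.inl ((hKH k hkL hkA).2 hk))
    · exact Or.inr ⟨hk, hkL⟩
  have hKsub : (K \ A) ∩ I₃ ⊆ H ∩ I₃ := by
    intro k hk
    rw [mem_inter, mem_sdiff] at hk
    exact mem_inter.2 ⟨(hKH k (mem_cell.1 hk.1.1).1 hk.1.2).1 hk.1.1, hk.2⟩
  by_cases hU : #H ≤ 2 * #(H ∩ (univ \ L))
  · have hsub := hHc.subset_denseRegion hU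
    apply heb.2
    refine hKc.subset_denseRegion ?_ heK
    have : #((K \ A) ∩ I₃) ≤ #(K ∩ (I₃ ∩ denseRegion univ p₀ 2 (univ \ L))) := by
      refine card_le_card fun k hk => ?_
      have hk' := mem_inter.1 (hKsub hk)
      rw [mem_inter, mem_sdiff] at hk
      exact mem_inter.2 ⟨hk.1.1, mem_inter.2 ⟨hk.2, hsub hk'.1⟩⟩
    omega
  · refine hwb.1.2 hw (hHc.subset_denseRegion ?_ hwH)
    have := card_le_card hKsub
    -- `3/4 #K ≤ 2 #(H ∩ I₃)` and `3/8 #H ≤ #K`, so `#H ≤ 64/9 #(H ∩ I₃)`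
    omega

/-- A permutation `py` that has the order of the first sample on `L`, and the order of the third
sample elsewhere and relative to the symbols of `L'`, is in the hidden order off `finalBad`. -/
theorem agreeOff_finalBad {p₀ p₁ p₃ py : V → ℕ} {L L' A I₃ : Finset V} {π : V → V}
    (h0 : Function.Injective p₀) (h1 : Function.Injective p₁) (hy : Function.Injective py)
    (hA : AgreeOff L A p₀ p₁) (hI₃ : AgreeOff univ I₃ p₀ p₃)
    (hL' : StackPairing L L' p₁ p₃ π)
    (hyL : AgreeOff L ∅ py p₁) (hyU : AgreeOff (univ \ (L \ L')) ∅ py p₃) :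
    AgreeOff univ (finalBad p₀ p₁ L A I₃) p₀ py := by
  have hmix := fun {w e : V} => lt_iff_lt_of_notMem_finalBad (w := w) (e := e)
    h0 h1 hy hA hI₃ hL' hyL hyU
  have hsing : I₃ ⊆ denseRegion univ p₀ 11 I₃ :=
    subset_denseRegion_self (subset_univ _) h0 (by norm_num)
  intro u _ v _ hu hv
  by_cases huL : u ∈ L <;> by_cases hvL : v ∈ L
  · exact (hA u huL v hvL (fun h => hu (by simp [finalBad, h]))
      (fun h => hv (by simp [finalBad, h]))).trans
      (hyL u huL v hvL (notMem_empty _) (notMem_empty _)).symm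
  · have hne : u ≠ v := fun h => hvL (h ▸ huL)
    have := hmix hvL huL hv hu
    have a := h0.ne hne
    have b := hy.ne hne
    omega
  · exact hmix huL hvL hu hv
  · refine (hI₃ u (mem_univ _) v (mem_univ _) (fun h => hu ?_) (fun h => hv ?_)).trans
      (hyU u (by simp [huL]) v (by simp [hvL]) (notMem_empty _) (notMem_empty _)).symm
    · simp [finalBad, huL, hsing h]
    · simp [finalBad, hvL, hsing h]

end Bad
end UlamMedian

namespace UlamMedian

/-! ### Averaging over triples -/

open Finset

section Averaging

variable {V ι Ω : Type*} [DecidableEq V] [Fintype ι] [Fintype Ω]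

theorem sum_card_denseRegion_le {I : Ω → Finset V} {p : Ω → V → ℕ} {M : ℝ}
    (hp : ∀ x, Function.Injective (p x)) (G : Ω → Finset V) (N : ℕ)
    (hM : ∑ x, (#(I x) : ℝ) ≤ M) :
    ∑ x, (#(denseRegion (G x) (p x) N (I x)) : ℝ) ≤ 2 * N * M := by
  calc ∑ x, (#(denseRegion (G x) (p x) N (I x)) : ℝ) ≤ ∑ x, 2 * N * (#(I x) : ℝ) :=
        Finset.sum_le_sum fun x _ => by exact_mod_cast card_denseRegion_le (G x) (hp x) N (I x)
    _ = 2 * N * ∑ x, (#(I x) : ℝ) := by rw [Finset.mul_sum]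
    _ ≤ _ := by gcongr

variable [Fintype V]

theorem sum_sum_card_inter_eq (Z : Ω → Finset V) (Y : ι → Finset V) :
    ∑ ω, ∑ x, (#(Z ω ∩ Y x) : ℝ) =
      ∑ u, (∑ ω, if u ∈ Z ω then (1 : ℝ) else 0) * ∑ x, if u ∈ Y x then (1 : ℝ) else 0 := by
  have h : ∀ ω x, (#(Z ω ∩ Y x) : ℝ) =
      ∑ u, (if u ∈ Z ω then (1 : ℝ) else 0) * if u ∈ Y x then (1 : ℝ) else 0 := by
    intro ω x
    simp only [← ite_and, mul_ite, mul_one, mul_zero]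
    rw [← Finset.sum_filter, Finset.sum_const, nsmul_eq_mul, mul_one]
    congr 2
    ext u
    simp [and_comm]
  simp only [h, Finset.sum_mul_sum]
  rw [Finset.sum_comm]
  simp_rw [Finset.sum_comm (s := (univ : Finset Ω)) (t := (univ : Finset V))]
  rw [Finset.sum_comm]
  refine Finset.sum_congr rfl fun u _ => ?_
  rw [Finset.sum_comm]

theorem sum_card_eq (Z : Ω → Finset V) :
    ∑ ω, (#(Z ω) : ℝ) = ∑ u, ∑ ω, if u ∈ Z ω then (1 : ℝ) else 0 := by
  rw [Finset.sum_comm]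
  refine Finset.sum_congr rfl fun ω _ => ?_
  simp

/-- If two independent random sets `Y` hardly meet, then no random set `Z` that is independent of
`Y` and not too large meets `Y` in many elements. An element that lies in `Y` with probability at
least `t` is paid for by the intersection of two copies of `Y`. -/
theorem sum_sum_card_inter_le [Nonempty ι] (Z : Ω → Finset V) (Y : ι → Finset V) {t : ℝ}
    (ht : 0 < t) :
    ∑ ω, ∑ x, (#(Z ω ∩ Y x) : ℝ) ≤ t * Fintype.card ι * ∑ ω, (#(Z ω) : ℝ) +
      Fintype.card Ω / (t * Fintype.card ι) * ∑ x, ∑ x', (#(Y x ∩ Y x') : ℝ) := by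
  have hn : (0 : ℝ) < Fintype.card ι := by exact_mod_cast Fintype.card_pos
  rw [sum_sum_card_inter_eq Z Y, sum_sum_card_inter_eq Y Y, sum_card_eq, Finset.mul_sum,
    Finset.mul_sum, ← Finset.sum_add_distrib]
  refine Finset.sum_le_sum fun u _ => ?_
  set z := ∑ ω, if u ∈ Z ω then (1 : ℝ) else 0 with hz
  set y := ∑ x, if u ∈ Y x then (1 : ℝ) else 0 with hy
  have hz0 : 0 ≤ z := Finset.sum_nonneg fun ω _ => by split_ifs <;> norm_num
  have hy0 : 0 ≤ y := Finset.sum_nonneg fun ω _ => by split_ifs <;> norm_num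
  have hzc : z ≤ Fintype.card Ω := by
    calc z ≤ ∑ _ω : Ω, (1 : ℝ) := Finset.sum_le_sum fun ω _ => by split_ifs <;> norm_num
      _ = _ := by simp
  have htn : 0 < t * Fintype.card ι := mul_pos ht hn
  have hc0 : (0 : ℝ) ≤ Fintype.card Ω := Nat.cast_nonneg _
  rcases le_total y (t * Fintype.card ι) with h | h
  · have h1 : 0 ≤ Fintype.card Ω / (t * Fintype.card ι) * (y * y) := by positivity
    nlinarith [mul_le_mul_of_nonneg_left h hz0]
  · have h1 : 0 ≤ t * Fintype.card ι * z := by positivity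
    have h2 : Fintype.card Ω * y ≤ Fintype.card Ω / (t * Fintype.card ι) * (y * y) := by
      rw [div_mul_eq_mul_div, le_div_iff₀ htn]
      nlinarith [mul_le_mul_of_nonneg_left h (mul_nonneg hc0 hy0)]
    nlinarith [mul_le_mul_of_nonneg_right hzc hy0]

section Expectation

variable [Nonempty ι] {p₀ : V → ℕ} {p : ι → V → ℕ} {I : ι → Finset V} {κ : ℝ}

/-- The averaging lemma for the family `I`, in the normalization that is used below. -/
theorem sum_sum_card_inter_le_of_le (Z : Ω → Finset V) {t B M : ℝ} (ht : 0 < t)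
    (hZ : ∑ ω, (#(Z ω) : ℝ) ≤ B * (Fintype.card Ω * M / Fintype.card ι))
    (hI : ∑ x, ∑ x', (#(I x ∩ I x') : ℝ) ≤ κ * (Fintype.card ι * M)) :
    ∑ ω, ∑ x, (#(Z ω ∩ I x) : ℝ) ≤ (B * t + κ / t) * (Fintype.card Ω * M) := by
  have hn : (0 : ℝ) < Fintype.card ι := by exact_mod_cast Fintype.card_pos
  refine (sum_sum_card_inter_le Z I ht).trans ?_
  calc _ ≤ t * Fintype.card ι * (B * (Fintype.card Ω * M / Fintype.card ι)) +
        Fintype.card Ω / (t * Fintype.card ι) * (κ * (Fintype.card ι * M)) := by gcongr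
    _ = _ := by field_simp

theorem card_firstBad_le (p₀ p₁ : V → ℕ) (I₁ I₂ : Finset V) :
    #(firstBad p₀ p₁ I₁ I₂) ≤ #(I₁ ∩ I₂) + #(denseRegion univ p₁ 4 I₁ ∩ I₂) +
      #(denseRegion univ p₀ 2 I₁ ∩ I₂) + #(denseRegion univ p₀ 8 I₂ ∩ I₁) := by
  rw [firstBad, inter_comm I₂ (denseRegion univ p₁ 4 I₁), inter_comm I₂ (denseRegion univ p₀ 2 I₁),
    inter_comm I₁ (denseRegion univ p₀ 8 I₂)]
  have h1 := card_union_le (I₁ ∩ I₂ ∪ denseRegion univ p₁ 4 I₁ ∩ I₂ ∪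
    denseRegion univ p₀ 2 I₁ ∩ I₂) (denseRegion univ p₀ 8 I₂ ∩ I₁)
  have h2 := card_union_le (I₁ ∩ I₂ ∪ denseRegion univ p₁ 4 I₁ ∩ I₂)
    (denseRegion univ p₀ 2 I₁ ∩ I₂)
  have h3 := card_union_le (I₁ ∩ I₂) (denseRegion univ p₁ 4 I₁ ∩ I₂)
  omega

theorem card_finalBad_le {p₀ p₁ : V → ℕ} (h0 : Function.Injective p₀)
    (h1 : Function.Injective p₁) (L A I₃ : Finset V) :
    #(finalBad p₀ p₁ L A I₃) ≤ 33 * #A + #((univ \ L) ∩ denseRegion univ p₀ 11 I₃) +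
      8 * #(denseRegion univ p₀ 2 (univ \ L) ∩ I₃) := by
  rw [finalBad, inter_comm I₃]
  have e1 := card_denseRegion_le L h1 8 A
  have e2 := card_denseRegion_le univ h0 8 A
  have e3 := card_denseRegion_le L h1 4 (denseRegion univ p₀ 2 (univ \ L) ∩ I₃)
  have c1 := card_union_le (A ∪ denseRegion L p₁ 8 A ∪ denseRegion univ p₀ 8 A ∪
    (univ \ L) ∩ denseRegion univ p₀ 11 I₃)
    (denseRegion L p₁ 4 (denseRegion univ p₀ 2 (univ \ L) ∩ I₃))
  have c2 := card_union_le (A ∪ denseRegion L p₁ 8 A ∪ denseRegion univ p₀ 8 A)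
    ((univ \ L) ∩ denseRegion univ p₀ 11 I₃)
  have c3 := card_union_le (A ∪ denseRegion L p₁ 8 A) (denseRegion univ p₀ 8 A)
  have c4 := card_union_le A (denseRegion L p₁ 8 A)
  omega

/-- The dense regions of two independent random sets hardly meet. -/
theorem sum_sum_card_denseRegion_inter_le {t M : ℝ} (h0 : Function.Injective p₀) (N : ℕ)
    (ht : 0 < t) (hM : ∑ x, (#(I x) : ℝ) ≤ M)
    (hI : ∑ x, ∑ x', (#(I x ∩ I x') : ℝ) ≤ κ * (Fintype.card ι * M)) :
    ∑ x, ∑ x', (#(denseRegion univ p₀ N (I x) ∩ denseRegion univ p₀ N (I x')) : ℝ) ≤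
      4 * N * (4 * N * t + κ / t) * (Fintype.card ι * M) := by
  have hn : (0 : ℝ) < Fintype.card ι := by exact_mod_cast Fintype.card_pos
  have hkey : ∑ x, ∑ x', (#(denseRegion univ p₀ (2 * N) (I x) ∩ I x') : ℝ) ≤
      (4 * N * t + κ / t) * (Fintype.card ι * M) := by
    refine sum_sum_card_inter_le_of_le _ ht ?_ hI
    rw [mul_div_cancel_left₀ _ hn.ne']
    refine (sum_card_denseRegion_le (fun _ => h0) (fun _ => univ) (2 * N) hM).trans (le_of_eq ?_)
    push_cast
    ring
  have hkey' : ∑ x, ∑ x', (#(denseRegion univ p₀ (2 * N) (I x') ∩ I x) : ℝ) ≤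
      (4 * N * t + κ / t) * (Fintype.card ι * M) := by
    rwa [Finset.sum_comm]
  have hle : ∀ x x', (#(denseRegion univ p₀ N (I x) ∩ denseRegion univ p₀ N (I x')) : ℝ) ≤
      2 * N * #(denseRegion univ p₀ (2 * N) (I x') ∩ I x) +
        2 * N * #(denseRegion univ p₀ (2 * N) (I x) ∩ I x') := by
    intro x x'
    have h1 := card_le_card (denseRegion_inter_subset univ p₀ N (I x) (I x'))
    have h2 := card_union_le (denseRegion univ p₀ N (I x ∩ denseRegion univ p₀ (2 * N) (I x')))
      (denseRegion univ p₀ N (I x' ∩ denseRegion univ p₀ (2 * N) (I x)))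
    have h3 := card_denseRegion_le univ h0 N (I x ∩ denseRegion univ p₀ (2 * N) (I x'))
    have h4 := card_denseRegion_le univ h0 N (I x' ∩ denseRegion univ p₀ (2 * N) (I x))
    rw [inter_comm (I x)] at h3
    rw [inter_comm (I x')] at h4
    rw [inter_comm (I x) (denseRegion univ p₀ (2 * N) (I x')),
      inter_comm (I x') (denseRegion univ p₀ (2 * N) (I x))] at h2 h1
    exact_mod_cast h1.trans (h2.trans (add_le_add h3 h4))
  calc _ ≤ ∑ x, ∑ x', (2 * N * (#(denseRegion univ p₀ (2 * N) (I x') ∩ I x) : ℝ) +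
        2 * N * #(denseRegion univ p₀ (2 * N) (I x) ∩ I x')) :=
        Finset.sum_le_sum fun x _ => Finset.sum_le_sum fun x' _ => hle x x'
    _ = 2 * N * ∑ x, ∑ x', (#(denseRegion univ p₀ (2 * N) (I x') ∩ I x) : ℝ) +
        2 * N * ∑ x, ∑ x', (#(denseRegion univ p₀ (2 * N) (I x) ∩ I x') : ℝ) := by
        simp only [Finset.sum_add_distrib, Finset.mul_sum]
    _ ≤ 2 * N * ((4 * N * t + κ / t) * (Fintype.card ι * M)) +
        2 * N * ((4 * N * t + κ / t) * (Fintype.card ι * M)) := by gcongr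
    _ = _ := by ring

theorem sum_sum_card_firstBad_le {t M : ℝ} (h0 : Function.Injective p₀)
    (hp : ∀ x, Function.Injective (p x)) (ht : 0 < t) (hM : ∑ x, (#(I x) : ℝ) ≤ M)
    (hI : ∑ x, ∑ x', (#(I x ∩ I x') : ℝ) ≤ κ * (Fintype.card ι * M)) :
    ∑ x, ∑ x', (#(firstBad p₀ (p x) (I x) (I x')) : ℝ) ≤
      (κ + 28 * t + 3 * (κ / t)) * (Fintype.card ι * M) := by
  have hn : (0 : ℝ) < Fintype.card ι := by exact_mod_cast Fintype.card_pos
  have h1 : ∑ x, ∑ x', (#(denseRegion univ (p x) 4 (I x) ∩ I x') : ℝ) ≤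
      (8 * t + κ / t) * (Fintype.card ι * M) := by
    refine sum_sum_card_inter_le_of_le _ ht ?_ hI
    rw [mul_div_cancel_left₀ _ hn.ne']
    exact (sum_card_denseRegion_le hp (fun _ => univ) 4 hM).trans (le_of_eq (by norm_num))
  have h2 : ∑ x, ∑ x', (#(denseRegion univ p₀ 2 (I x) ∩ I x') : ℝ) ≤
      (4 * t + κ / t) * (Fintype.card ι * M) := by
    refine sum_sum_card_inter_le_of_le _ ht ?_ hI
    rw [mul_div_cancel_left₀ _ hn.ne']
    exact (sum_card_denseRegion_le (fun _ => h0) (fun _ => univ) 2 hM).trans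
      (le_of_eq (by norm_num))
  have h3 : ∑ x, ∑ x', (#(denseRegion univ p₀ 8 (I x') ∩ I x) : ℝ) ≤
      (16 * t + κ / t) * (Fintype.card ι * M) := by
    rw [Finset.sum_comm]
    refine sum_sum_card_inter_le_of_le _ ht ?_ hI
    rw [mul_div_cancel_left₀ _ hn.ne']
    exact (sum_card_denseRegion_le (fun _ => h0) (fun _ => univ) 8 hM).trans
      (le_of_eq (by norm_num))
  calc _ ≤ ∑ x, ∑ x', ((#(I x ∩ I x') : ℝ) + #(denseRegion univ (p x) 4 (I x) ∩ I x') +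
        #(denseRegion univ p₀ 2 (I x) ∩ I x') + #(denseRegion univ p₀ 8 (I x') ∩ I x)) :=
        Finset.sum_le_sum fun x _ => Finset.sum_le_sum fun x' _ => by
          exact_mod_cast card_firstBad_le p₀ (p x) (I x) (I x')
    _ ≤ κ * (Fintype.card ι * M) + (8 * t + κ / t) * (Fintype.card ι * M) +
        (4 * t + κ / t) * (Fintype.card ι * M) + (16 * t + κ / t) * (Fintype.card ι * M) := by
        simp only [Finset.sum_add_distrib]
        gcongr
    _ = _ := by ring

/-- If two random sets `I` hardly meet, then the expected number of elements that may be out of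
order in the output is a small fraction of the expected size of `I`. -/
theorem sum_card_finalBad_le {M : ℝ} (h0 : Function.Injective p₀)
    (hp : ∀ x, Function.Injective (p x)) (hM : ∑ x, (#(I x) : ℝ) = M)
    (hI : ∑ x, ∑ x', (#(I x ∩ I x') : ℝ) ≤ 1 / 10 ^ 20 * (Fintype.card ι * M))
    (L : ι → ι → Finset V) (hL : ∀ x y, #(univ \ L x y) ≤ 2 * (#(I x) + #(I y))) :
    ∑ x, ∑ y, ∑ z, (#(finalBad p₀ (p x) (L x y) (firstBad p₀ (p x) (I x) (I y)) (I z)) : ℝ) ≤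
      (Fintype.card ι) ^ 2 * M / 200 := by
  -- The averaging lemma is applied with the threshold `1 / 10 ^ 10`, and with `1 / 2000` where the
  -- sets `Y` are dense regions: these overlap in about a fraction `10 ^ (-7)`, and `10 ^ (-7)`
  -- divided by the threshold still has to be small.
  set n : ℝ := ((Fintype.card ι : ℕ) : ℝ) with hndef
  have hn : (0 : ℝ) < n := by rw [hndef]; exact_mod_cast Fintype.card_pos
  have hM0 : 0 ≤ M := hM ▸ Finset.sum_nonneg fun x _ => Nat.cast_nonneg _
  have ht : (0 : ℝ) < 1 / 10 ^ 10 := by norm_num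
  have hA := sum_sum_card_firstBad_le h0 hp ht hM.le hI
  have hR := sum_sum_card_denseRegion_inter_le h0 11 ht hM.le hI
  have hcard : (Fintype.card (ι × ι) : ℝ) = n * n := by
    rw [Fintype.card_prod]; push_cast; rfl
  have hU : ∑ ω : ι × ι, (#(univ \ L ω.1 ω.2) : ℝ) ≤ 4 * (n * M) := by
    calc _ ≤ ∑ ω : ι × ι, (2 * ((#(I ω.1) : ℝ) + #(I ω.2))) :=
          Finset.sum_le_sum fun ω _ => by exact_mod_cast hL ω.1 ω.2
      _ = 4 * (n * M) := by
          rw [Fintype.sum_prod_type]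
          simp only [mul_add, Finset.sum_add_distrib, ← Finset.mul_sum, Finset.sum_const, hM,
            nsmul_eq_mul, Finset.card_univ]
          ring
  have hU3 : ∑ ω : ι × ι, ∑ z, (#((univ \ L ω.1 ω.2) ∩ denseRegion univ p₀ 11 (I z)) : ℝ) ≤
      (4 * (1 / 2000) + 4 * (11 : ℕ) *
        (4 * (11 : ℕ) * (1 / 10 ^ 10) + 1 / 10 ^ 20 / (1 / 10 ^ 10)) / (1 / 2000)) * (Fintype.card (ι × ι) * M) := by
    refine sum_sum_card_inter_le_of_le _ (by norm_num) ?_ hR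
    refine hU.trans (le_of_eq ?_)
    rw [hcard]
    field_simp [hn.ne']
    rw [← hndef]
    ring
  have hQ : ∑ ω : ι × ι, ∑ z, (#(denseRegion univ p₀ 2 (univ \ L ω.1 ω.2) ∩ I z) : ℝ) ≤
      (16 * (1 / 10 ^ 10) + 1 / 10 ^ 20 / (1 / 10 ^ 10)) * (Fintype.card (ι × ι) * M) := by
    refine sum_sum_card_inter_le_of_le _ ht ?_ hI
    refine (sum_card_denseRegion_le (fun _ => h0) (fun _ => univ) 2 hU).trans (le_of_eq ?_)
    rw [hcard]
    field_simp
    rw [← hndef]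
    push_cast
    ring
  rw [Fintype.sum_prod_type] at hU3 hQ
  rw [hcard] at hU3 hQ
  calc _ ≤ ∑ x, ∑ y, ∑ z, (33 * (#(firstBad p₀ (p x) (I x) (I y)) : ℝ) +
        #((univ \ L x y) ∩ denseRegion univ p₀ 11 (I z)) +
        8 * #(denseRegion univ p₀ 2 (univ \ L x y) ∩ I z)) :=
        Finset.sum_le_sum fun x _ => Finset.sum_le_sum fun y _ => Finset.sum_le_sum fun z _ => by
          exact_mod_cast card_finalBad_le h0 (hp x) _ _ _
    _ = 33 * n * (∑ x, ∑ y, (#(firstBad p₀ (p x) (I x) (I y)) : ℝ)) +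
        ∑ x, ∑ y, ∑ z, (#((univ \ L x y) ∩ denseRegion univ p₀ 11 (I z)) : ℝ) +
        8 * ∑ x, ∑ y, ∑ z, (#(denseRegion univ p₀ 2 (univ \ L x y) ∩ I z) : ℝ) := by
        simp only [Finset.sum_add_distrib, Finset.sum_const, nsmul_eq_mul, Finset.card_univ,
          ← Finset.mul_sum]
        ring
    _ ≤ 33 * n * ((1 / 10 ^ 20 + 28 * (1 / 10 ^ 10) + 3 * (1 / 10 ^ 20 / (1 / 10 ^ 10))) *
          (n * M)) +
        (4 * (1 / 2000) + 4 * (11 : ℕ) * (4 * (11 : ℕ) * (1 / 10 ^ 10) +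
          1 / 10 ^ 20 / (1 / 10 ^ 10)) / (1 / 2000)) * (n * n * M) +
        8 * ((16 * (1 / 10 ^ 10) + 1 / 10 ^ 20 / (1 / 10 ^ 10)) * (n * n * M)) := by
        gcongr
    _ ≤ n ^ 2 * M / 200 := by
        have : 0 ≤ n ^ 2 * M := by positivity
        norm_num
        nlinarith

end Expectation
end Averaging
end UlamMedian

namespace UlamMedian

/-! ### Greedy removal of inversions and insertion of symbols -/

open Finset

section Stack

variable {V : Type*}

/-- One step of the greedy removal of inversions. The stack `st` (top first) holds the kept
symbols; the new symbol `s` annihilates with the top of the stack if they are inverted. -/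
def stackStep (q : V → ℕ) (st : List V) (s : V) : List V :=
  match st with
  | [] => [s]
  | t :: r => if q s < q t then r else s :: t :: r

/-- The stack after processing the string `P`, top first. -/
def stackRun (q : V → ℕ) (P : List V) : List V := P.foldl (stackStep q) []

theorem stackRun_append_singleton (q : V → ℕ) (P : List V) (s : V) :
    stackRun q (P ++ [s]) = stackStep q (stackRun q P) s := by
  simp [stackRun]

variable [DecidableEq V]

/-- The stack stays sorted for both `p` and `q`, and matching the symbols that annihilate each other
gives a pairing: two symbols annihilate only when everything between them has been removed, so no
kept symbol stands between the two. -/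
theorem stackRun_spec {p q : V → ℕ} (hq : Function.Injective q) (P : List V)
    (hP : P.Pairwise fun u v => p u < p v) :
    (stackRun q P).Pairwise (fun u v => q v < q u) ∧
    (stackRun q P).Pairwise (fun u v => p v < p u) ∧
      ∃ π, StackPairing P.toFinset (stackRun q P).toFinset p q π := by
  induction P using List.reverseRecOn with
  | nil =>
    simp only [stackRun, List.foldl_nil, List.Pairwise.nil, true_and]
    exact ⟨id, by simp, by simp, by simp, by simp, by simp, by simp⟩
  | append_singleton P s ih =>
    rw [List.pairwise_append] at hP
    obtain ⟨hP, -, hPs⟩ := hP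
    have hlast : ∀ u ∈ P, p u < p s := fun u hu => hPs u hu s (List.mem_singleton_self s)
    have hsP : s ∉ P := fun h => lt_irrefl _ (hlast s h)
    obtain ⟨hqs, hps, π, hπ⟩ := ih hP
    have hsub : ∀ u ∈ stackRun q P, u ∈ P := fun u hu => by
      simpa using hπ.subset (List.mem_toFinset.2 hu)
    have hG : ∀ u, u ∈ (P ++ [s]).toFinset ↔ u ∈ P ∨ u = s := by
      simp [or_comm]
    rw [stackRun_append_singleton]
    rcases hst : stackRun q P with _ | ⟨t, r⟩
    · rw [hst] at hπ
      refine ⟨by simp [stackStep], by simp [stackStep], π, ?_⟩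
      have hmem : ∀ u, u ∈ (stackStep q [] s).toFinset ↔ u = s := by simp [stackStep]
      have hold : ∀ u ∈ (P ++ [s]).toFinset, u ∉ (stackStep q [] s).toFinset →
          u ∈ P.toFinset ∧ u ∉ ([] : List V).toFinset := by
        intro u hu hu'
        rw [hmem] at hu'
        rw [hG] at hu
        exact ⟨List.mem_toFinset.2 (hu.resolve_right hu'), by simp⟩
      refine ⟨fun u hu => (hG u).2 (Or.inr ((hmem u).1 hu)), ?_, ?_, ?_, ?_, ?_⟩
      · intro u hu v hv huv
        rw [(hmem u).1 hu, (hmem v).1 hv] at huv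
        exact absurd huv (lt_irrefl _)
      · intro u hu hu'
        obtain ⟨h1, h2⟩ := hold u hu hu'
        have h3 := List.mem_toFinset.1 (hπ.maps u h1 h2).1
        exact ⟨(hG _).2 (Or.inl h3), fun h => hsP ((hmem _).1 h ▸ h3)⟩
      · intro u hu hu'
        obtain ⟨h1, h2⟩ := hold u hu hu'
        exact hπ.invol u h1 h2
      · intro u hu hu'
        obtain ⟨h1, h2⟩ := hold u hu hu'
        exact hπ.inverted u h1 h2
      · intro u hu hu' c hc
        obtain ⟨h1, h2⟩ := hold u hu hu'
        have h3 := List.mem_toFinset.1 (hπ.maps u h1 h2).1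
        have h4 := hlast u (List.mem_toFinset.1 h1)
        have h5 := hlast _ h3
        rw [(hmem c).1 hc]
        omega
    · rw [hst] at hπ hqs hps hsub
      have ht : t ∈ P := hsub t List.mem_cons_self
      have hts : t ≠ s := fun h => hsP (h ▸ ht)
      rw [List.pairwise_cons] at hqs hps
      by_cases hlt : q s < q t
      · -- The symbols `s` and `t` annihilate.
        have hstep : stackStep q (t :: r) s = r := by simp [stackStep, hlt]
        rw [hstep]
        have htr : t ∉ r := fun h => lt_irrefl _ (hps.1 t h)
        have hsr : s ∉ r := fun h => hsP (hsub s (List.mem_cons_of_mem _ h))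
        refine ⟨hqs.2, hps.2, fun u => if u = s then t else if u = t then s else π u, ?_⟩
        have hold : ∀ u ∈ (P ++ [s]).toFinset, u ∉ r.toFinset → u = s ∨ u = t ∨
            (u ≠ s ∧ u ≠ t ∧ π u ≠ s ∧ π u ≠ t ∧ u ∈ P.toFinset ∧ u ∉ (t :: r).toFinset) := by
          intro u hu hu'
          rw [hG] at hu
          rw [List.mem_toFinset] at hu'
          by_cases h1 : u = s
          · exact Or.inl h1
          by_cases h2 : u = t
          · exact Or.inr (Or.inl h2)
          have h3 : u ∈ P.toFinset := List.mem_toFinset.2 (hu.resolve_right h1)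
          have h4 : u ∉ (t :: r).toFinset := by simp [h2, hu']
          have h5 := hπ.maps u h3 h4
          refine Or.inr (Or.inr ⟨h1, h2, fun h => hsP ?_, fun h => h5.2 ?_, h3, h4⟩)
          · rw [← h]; exact List.mem_toFinset.1 h5.1
          · rw [h]; simp
        have hpt := hlast t ht
        refine ⟨?_, ?_, ?_, ?_, ?_, ?_⟩
        · intro u hu
          exact (hG u).2 (Or.inl (hsub u (List.mem_cons_of_mem _ (List.mem_toFinset.1 hu))))
        · intro u hu v hv
          exact hπ.mono u (by simp at hu ⊢; exact Or.inr hu) v (by simp at hv ⊢; exact Or.inr hv)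
        · intro u hu hu'
          rcases hold u hu hu' with rfl | rfl | ⟨h1, h2, h3, h4, h5, h6⟩
          · simp [ht, htr]
          · simp [hts, hsr]
          · have h7 := hπ.maps u h5 h6
            simp only [h1, h2, if_false, hG]
            exact ⟨Or.inl (List.mem_toFinset.1 h7.1), fun h => h7.2 (by
              simp at h ⊢; exact Or.inr h)⟩
        · intro u hu hu'
          rcases hold u hu hu' with rfl | rfl | ⟨h1, h2, h3, h4, h5, h6⟩
          · simp [hts]
          · simp [hts]
          · simp [h1, h2, h3, h4, hπ.invol u h5 h6]
        · intro u hu hu'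
          rcases hold u hu hu' with rfl | rfl | ⟨h1, h2, h3, h4, h5, h6⟩
          · simp [hpt, hlt]
          · simp [hts, hpt, hlt]
          · simpa [h1, h2] using hπ.inverted u h5 h6
        · intro u hu hu' c hc
          have hcr := List.mem_toFinset.1 hc
          have hct := hps.1 c hcr
          rcases hold u hu hu' with rfl | rfl | ⟨h1, h2, h3, h4, h5, h6⟩
          · simp only [if_true]; omega
          · simp only [hts, if_false, if_true]; omega
          · simp only [h1, h2, if_false]
            exact hπ.separated u h5 h6 c (by simp [hcr])
      · have hstep : stackStep q (t :: r) s = s :: t :: r := by simp [stackStep, hlt]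
        rw [hstep]
        have hqt : q t < q s := lt_of_le_of_ne (not_lt.1 hlt) (hq.ne hts)
        have hqall : ∀ v ∈ t :: r, q v < q s := by
          intro v hv
          rcases List.mem_cons.1 hv with rfl | hv
          · exact hqt
          · exact (hqs.1 v hv).trans hqt
        have hpall : ∀ v ∈ t :: r, p v < p s := fun v hv => hlast v (hsub v hv)
        refine ⟨List.pairwise_cons.2 ⟨hqall, List.pairwise_cons.2 hqs⟩,
          List.pairwise_cons.2 ⟨hpall, List.pairwise_cons.2 hps⟩, π, ?_⟩
        have hmem : ∀ u, u ∈ (s :: t :: r).toFinset ↔ u = s ∨ u ∈ (t :: r) := by simp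
        have hold : ∀ u ∈ (P ++ [s]).toFinset, u ∉ (s :: t :: r).toFinset →
            u ∈ P.toFinset ∧ u ∉ (t :: r).toFinset := by
          intro u hu hu'
          rw [hmem, not_or] at hu'
          rw [hG] at hu
          exact ⟨List.mem_toFinset.2 (hu.resolve_right hu'.1), by simpa using hu'.2⟩
        refine ⟨?_, ?_, ?_, ?_, ?_, ?_⟩
        · intro u hu
          exact (hG u).2 (((hmem u).1 hu).symm.imp_left (hsub u))
        · intro u hu v hv huv
          rcases (hmem u).1 hu with hus | hur <;> rcases (hmem v).1 hv with hvs | hvr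
          · exact absurd huv (by rw [hus, hvs]; exact lt_irrefl _)
          · exact absurd huv (by rw [hus]; exact (hpall v hvr).asymm)
          · rw [hvs]
            exact hqall u hur
          · exact hπ.mono u (List.mem_toFinset.2 hur) v (List.mem_toFinset.2 hvr) huv
        · intro u hu hu'
          obtain ⟨h1, h2⟩ := hold u hu hu'
          have h3 := hπ.maps u h1 h2
          have h4 := List.mem_toFinset.1 h3.1
          refine ⟨(hG _).2 (Or.inl h4), fun h => ?_⟩
          rcases (hmem _).1 h with h | h
          · exact hsP (h ▸ h4)
          · exact h3.2 (List.mem_toFinset.2 h)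
        · intro u hu hu'
          obtain ⟨h1, h2⟩ := hold u hu hu'
          exact hπ.invol u h1 h2
        · intro u hu hu'
          obtain ⟨h1, h2⟩ := hold u hu hu'
          exact hπ.inverted u h1 h2
        · intro u hu hu' c hc
          obtain ⟨h1, h2⟩ := hold u hu hu'
          have h3 := List.mem_toFinset.1 (hπ.maps u h1 h2).1
          have h4 := hlast u (List.mem_toFinset.1 h1)
          have h5 := hlast _ h3
          rcases (hmem c).1 hc with rfl | hc
          · omega
          · exact hπ.separated u h1 h2 c (List.mem_toFinset.2 hc)

end Stack

section Weave

variable {V : Type*} [DecidableEq V]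

/-- Merges the strings `xs` and `ls`. A symbol of `xs` that is not in `A` is copied; a symbol of `A`
that is not in `A'` is skipped, and a symbol of `A'` causes `ls` to be copied up to and including
this symbol. What is left of `ls` is copied in the end. -/
def weave (A A' : List V) : List V → List V → List V
  | [], ls => ls
  | s :: xs, ls =>
    if s ∈ A then
      if s ∈ A' then
        match ls with
        | [] => weave A A' xs []
        | l :: ls => l :: if l = s then weave A A' xs ls else weave A A' (s :: xs) ls
      else weave A A' xs ls
    else s :: weave A A' xs ls
  termination_by xs ls => xs.length + ls.length

variable {A A' : List V} {s l : V} {xs ls : List V}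

theorem weave_nil (A A' ls : List V) : weave A A' [] ls = ls := by
  rw [weave]

theorem weave_cons_of_notMem (h : s ∉ A) :
    weave A A' (s :: xs) ls = s :: weave A A' xs ls := by
  rw [weave.eq_def]
  simp [h]

theorem weave_cons_of_mem_of_notMem (h : s ∈ A) (h' : s ∉ A') :
    weave A A' (s :: xs) ls = weave A A' xs ls := by
  rw [weave.eq_def]
  simp [h, h']

theorem weave_cons_cons (h : s ∈ A) (h' : s ∈ A') :
    weave A A' (s :: xs) (l :: ls) =
      l :: if l = s then weave A A' xs ls else weave A A' (s :: xs) ls := by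
  rw [weave.eq_def]
  simp [h, h']

/-- When `xs` and `ls` contain the symbols of `A'` in the same order, `weave` keeps the order of
`ls` on the symbols of `A`, and the order of `xs` on the symbols of `A'` and those outside `A`. -/
theorem filter_weave (hA : A' ⊆ A) : ∀ (n : ℕ) (xs ls : List V), xs.length + ls.length = n →
    (∀ l ∈ ls, l ∈ A) → xs.filter (· ∈ A') = ls.filter (· ∈ A') →
    (weave A A' xs ls).filter (· ∈ A) = ls ∧
      (weave A A' xs ls).filter (fun v => v ∉ A ∨ v ∈ A') =
        xs.filter (fun v => v ∉ A ∨ v ∈ A') := by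
  intro n
  induction n using Nat.strong_induction_on with
  | _ n ih =>
  intro xs ls hn hls h
  rcases xs with _ | ⟨s, xs⟩
  · rw [weave_nil]
    refine ⟨by simpa using hls, ?_⟩
    rw [List.filter_nil, eq_comm, List.filter_eq_nil_iff] at h
    rw [List.filter_nil, List.filter_eq_nil_iff]
    intro a ha
    have h1 := h a ha
    have h2 := hls a ha
    simp_all
  rw [List.length_cons] at hn
  by_cases hs : s ∈ A
  · by_cases hs' : s ∈ A'
    · rcases ls with _ | ⟨l, ls⟩
      · simp [hs'] at h
      · rw [List.length_cons] at hn
        rw [weave_cons_cons hs hs']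
        rw [List.forall_mem_cons] at hls
        rcases eq_or_ne l s with rfl | hne
        · rw [List.filter_cons_of_pos (by simpa using hs'),
            List.filter_cons_of_pos (by simpa using hs'), List.cons.injEq] at h
          obtain ⟨h1, h2⟩ := ih _ (by omega) xs ls rfl hls.2 h.2
          simp only [if_true]
          rw [List.filter_cons_of_pos (by simpa using hs), h1,
            List.filter_cons_of_pos (by simpa using Or.inr hs'), h2,
            List.filter_cons_of_pos (by simpa using Or.inr hs')]
          exact ⟨rfl, rfl⟩
        · have hl : l ∉ A' := by
            intro hl
            rw [List.filter_cons_of_pos (by simpa using hs'),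
              List.filter_cons_of_pos (by simpa using hl), List.cons.injEq] at h
            exact hne h.1.symm
          rw [List.filter_cons_of_neg (a := l) (by simpa using hl)] at h
          obtain ⟨h1, h2⟩ := ih _ (by simp; omega) (s :: xs) ls rfl hls.2 h
          simp only [hne, if_false]
          rw [List.filter_cons_of_pos (by simpa using hls.1), h1,
            List.filter_cons_of_neg (a := l) (by simp [hls.1, hl]), h2]
          exact ⟨rfl, rfl⟩
    · rw [weave_cons_of_mem_of_notMem hs hs']
      rw [List.filter_cons_of_neg (by simpa using hs')] at h
      obtain ⟨h1, h2⟩ := ih _ (by omega) xs ls rfl hls h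
      rw [List.filter_cons_of_neg (a := s) (by simp [hs, hs'])]
      exact ⟨h1, h2⟩
  · have hs' : s ∉ A' := fun h => hs (hA h)
    rw [weave_cons_of_notMem hs]
    rw [List.filter_cons_of_neg (by simpa using hs')] at h
    obtain ⟨h1, h2⟩ := ih _ (by omega) xs ls rfl hls h
    rw [List.filter_cons_of_neg (by simpa using hs), h1,
      List.filter_cons_of_pos (by simpa using Or.inl hs), h2,
      List.filter_cons_of_pos (by simpa using Or.inl hs)]
    exact ⟨rfl, rfl⟩

end Weave
end UlamMedian

namespace UlamMedian

/-! ### The candidate center of three permutations -/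

open Finset

section Order

theorem lt_iff_lt_of_pairwise {V : Type*} {p q : V → ℕ} {l : List V}
    (hp : l.Pairwise fun u v => p u < p v) (hq : l.Pairwise fun u v => q u < q v) {u v : V}
    (hu : u ∈ l) (hv : v ∈ l) : p u < p v ↔ q u < q v := by
  rw [List.pairwise_iff_getElem] at hp hq
  obtain ⟨i, hi, rfl⟩ := List.getElem_of_mem hu
  obtain ⟨j, hj, rfl⟩ := List.getElem_of_mem hv
  rcases lt_trichotomy i j with h | rfl | h
  · exact iff_of_true (hp i j hi hj h) (hq i j hi hj h)
  · simp
  · exact iff_of_false (hp j i hj hi h).asymm (hq j i hj hi h).asymm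

variable {d : ℕ}

/-- The position of the symbol `u` in the string of `x`. -/
def rank (x : Equiv.Perm (Fin d)) (u : Fin d) : ℕ := x.symm u

theorem rank_injective (x : Equiv.Perm (Fin d)) : Function.Injective (rank x) :=
  fun _ _ h => x.symm.injective (Fin.ext h)

theorem mem_word (x : Equiv.Perm (Fin d)) (u : Fin d) : u ∈ word x := by
  simpa [word, List.mem_ofFn] using x.surjective u

theorem length_word (x : Equiv.Perm (Fin d)) : (word x).length = d := by simp [word]

theorem pairwise_rank_word (x : Equiv.Perm (Fin d)) :
    (word x).Pairwise fun u v => rank x u < rank x v := by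
  rw [word, List.pairwise_ofFn]
  intro i j hij
  simpa [rank] using hij

theorem nodup_of_pairwise_lt {V : Type*} {p : V → ℕ} {l : List V}
    (h : l.Pairwise fun u v => p u < p v) : l.Nodup :=
  List.Pairwise.imp (fun {a b} hab (he : a = b) => lt_irrefl (p b) (he ▸ hab)) h

theorem nodup_word (x : Equiv.Perm (Fin d)) : (word x).Nodup :=
  nodup_of_pairwise_lt (pairwise_rank_word x)

theorem exists_word_eq {l : List (Fin d)} (hl : l.Nodup) (hlen : l.length = d) :
    ∃ y : Equiv.Perm (Fin d), word y = l := by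
  refine ⟨Equiv.ofBijective (fun i => l.get (i.cast hlen.symm))
    ((Finite.injective_iff_bijective).1 ?_), ?_⟩
  · exact (List.nodup_iff_injective_get.1 hl).comp (Fin.cast_injective _)
  · apply List.ext_getElem
    · simp [word, hlen]
    · intro i h1 h2
      simp [word]

theorem bddAbove_lcs {α : Type*} (a b : List α) :
    BddAbove {n : ℕ | ∃ l : List α, l.Sublist a ∧ l.Sublist b ∧ l.length = n} := by
  refine ⟨a.length, ?_⟩
  rintro n ⟨l, hl, -, rfl⟩
  exact hl.length_le

/-- The Ulam distance is at most the number of symbols whose removal makes the two orders agree. -/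
theorem ulamDist_le_card {x y : Equiv.Perm (Fin d)} {J : Finset (Fin d)}
    (h : AgreeOff univ J (rank x) (rank y)) : ulamDist x y ≤ #J := by
  set l := (word x).filter (· ∉ J) with hl
  have hlx : l.Sublist (word x) := List.filter_sublist
  have hly : l = (word y).filter (· ∉ J) := by
    have hx : l.Pairwise fun u v => rank y u < rank y v := by
      refine ((pairwise_rank_word x).sublist hlx).imp_of_mem fun {a b} ha hb hab => ?_
      exact (h a (mem_univ _) b (mem_univ _) (by simpa using (List.mem_filter.1 ha).2)
        (by simpa using (List.mem_filter.1 hb).2)).1 hab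
    have hy : ((word y).filter (· ∉ J)).Pairwise fun u v => rank y u < rank y v :=
      (pairwise_rank_word y).sublist List.filter_sublist
    refine List.Perm.eq_of_pairwise (fun a b _ _ h1 h2 => absurd h1 h2.asymm) hx hy ?_
    refine (List.perm_ext_iff_of_nodup (nodup_of_pairwise_lt hx) (nodup_of_pairwise_lt hy)).2 ?_
    intro a
    simp [hl, mem_word]
  have hlen : l.length = d - #J := by
    have h1 : l.toFinset = univ \ J := by
      ext a
      simp [hl, mem_word]
    rw [← List.toFinset_card_of_nodup ((nodup_word x).sublist hlx), h1,
      card_sdiff_of_subset (subset_univ _), card_univ, Fintype.card_fin]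
  have := le_csSup (bddAbove_lcs (word x) (word y))
    ⟨l, hlx, hly ▸ List.filter_sublist, hlen⟩
  rw [ulamDist, lcsLength]
  omega

/-- The symbols outside of a longest common subsequence. -/
theorem exists_card_eq_ulamDist (x y : Equiv.Perm (Fin d)) :
    ∃ J : Finset (Fin d), #J = ulamDist x y ∧ AgreeOff univ J (rank x) (rank y) := by
  obtain ⟨l, hlx, hly, hlen⟩ := Nat.sSup_mem
    (s := {n : ℕ | ∃ l : List (Fin d), l.Sublist (word x) ∧ l.Sublist (word y) ∧ l.length = n})
    ⟨0, [], by simp, by simp, rfl⟩ (bddAbove_lcs _ _)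
  refine ⟨univ \ l.toFinset, ?_, ?_⟩
  · rw [card_sdiff_of_subset (subset_univ _), card_univ, Fintype.card_fin,
      List.toFinset_card_of_nodup ((nodup_word x).sublist hlx), hlen]
    rfl
  · intro u _ v _ hu hv
    refine lt_iff_lt_of_pairwise ((pairwise_rank_word x).sublist hlx)
      ((pairwise_rank_word y).sublist hly) ?_ ?_
    · simpa using hu
    · simpa using hv

/-- The symbols kept by the greedy removal of the inversions between `x₁` and `x₂`. -/
def firstKept (x₁ x₂ : Equiv.Perm (Fin d)) : List (Fin d) :=
  (stackRun (rank x₂) (word x₁)).reverse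

/-- The symbols kept by the greedy removal of the inversions between `firstKept x₁ x₂` and
`x₃`. -/
def secondKept (x₁ x₂ x₃ : Equiv.Perm (Fin d)) : List (Fin d) :=
  (stackRun (rank x₃) (firstKept x₁ x₂)).reverse

/-- The string of the candidate center: the symbols of `firstKept x₁ x₂` in this order, with the
other symbols inserted where the third sample has them relative to `secondKept x₁ x₂ x₃`. -/
def candidateWord (x₁ x₂ x₃ : Equiv.Perm (Fin d)) : List (Fin d) :=
  weave (firstKept x₁ x₂) (secondKept x₁ x₂ x₃) (word x₃) (firstKept x₁ x₂)

theorem firstKept_spec (x₁ x₂ : Equiv.Perm (Fin d)) :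
    (firstKept x₁ x₂).Pairwise (fun u v => rank x₁ u < rank x₁ v) ∧
      ∃ π, StackPairing univ (firstKept x₁ x₂).toFinset (rank x₁) (rank x₂) π := by
  obtain ⟨-, h, π, hπ⟩ := stackRun_spec (rank_injective x₂) (word x₁) (pairwise_rank_word x₁)
  refine ⟨List.pairwise_reverse.2 h, π, ?_⟩
  rw [firstKept, List.toFinset_reverse]
  convert hπ
  ext u
  simp [mem_word]

theorem secondKept_spec (x₁ x₂ x₃ : Equiv.Perm (Fin d)) :
    (secondKept x₁ x₂ x₃).Pairwise (fun u v => rank x₁ u < rank x₁ v) ∧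
    (secondKept x₁ x₂ x₃).Pairwise (fun u v => rank x₃ u < rank x₃ v) ∧
      ∃ π, StackPairing (firstKept x₁ x₂).toFinset (secondKept x₁ x₂ x₃).toFinset (rank x₁)
        (rank x₃) π := by
  obtain ⟨h1, h, π, hπ⟩ := stackRun_spec (rank_injective x₃) (firstKept x₁ x₂)
    (firstKept_spec x₁ x₂).1
  refine ⟨List.pairwise_reverse.2 h, List.pairwise_reverse.2 h1, π, ?_⟩
  rwa [secondKept, List.toFinset_reverse]

theorem secondKept_subset (x₁ x₂ x₃ : Equiv.Perm (Fin d)) :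
    secondKept x₁ x₂ x₃ ⊆ firstKept x₁ x₂ := by
  obtain ⟨-, -, π, hπ⟩ := secondKept_spec x₁ x₂ x₃
  intro u hu
  simpa using hπ.subset (List.mem_toFinset.2 hu)

theorem filter_word_eq_of_pairwise {x : Equiv.Perm (Fin d)} {l : List (Fin d)}
    (h : l.Pairwise fun u v => rank x u < rank x v) : (word x).filter (· ∈ l) = l := by
  refine List.Perm.eq_of_pairwise (fun a b _ _ h1 h2 => absurd h1 h2.asymm)
    ((pairwise_rank_word x).sublist List.filter_sublist) h ?_
  refine (List.perm_ext_iff_of_nodup ((nodup_word x).sublist List.filter_sublist)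
    (nodup_of_pairwise_lt h)).2 fun a => ?_
  simp [mem_word]

theorem filter_mem_secondKept (x₁ x₂ x₃ : Equiv.Perm (Fin d)) :
    (word x₃).filter (· ∈ secondKept x₁ x₂ x₃) =
      (firstKept x₁ x₂).filter (· ∈ secondKept x₁ x₂ x₃) := by
  obtain ⟨h1, h3, -⟩ := secondKept_spec x₁ x₂ x₃
  rw [filter_word_eq_of_pairwise h3, eq_comm]
  have hf := (firstKept_spec x₁ x₂).1
  refine List.Perm.eq_of_pairwise (fun a b _ _ h1 h2 => absurd h1 h2.asymm)
    (hf.sublist List.filter_sublist) h1 ?_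
  refine (List.perm_ext_iff_of_nodup ((nodup_of_pairwise_lt hf).sublist List.filter_sublist)
    (nodup_of_pairwise_lt h1)).2 fun a => ?_
  simpa using @secondKept_subset d x₁ x₂ x₃ a

theorem filter_candidateWord (x₁ x₂ x₃ : Equiv.Perm (Fin d)) :
    (candidateWord x₁ x₂ x₃).filter (· ∈ firstKept x₁ x₂) = firstKept x₁ x₂ ∧
      (candidateWord x₁ x₂ x₃).filter (fun v => v ∉ firstKept x₁ x₂ ∨ v ∈ secondKept x₁ x₂ x₃) =
        (word x₃).filter (fun v => v ∉ firstKept x₁ x₂ ∨ v ∈ secondKept x₁ x₂ x₃) :=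
  filter_weave (secondKept_subset x₁ x₂ x₃) _ _ _ rfl (fun _ h => h)
    (filter_mem_secondKept x₁ x₂ x₃)

theorem exists_word_eq_candidateWord (x₁ x₂ x₃ : Equiv.Perm (Fin d)) :
    ∃ y : Equiv.Perm (Fin d), word y = candidateWord x₁ x₂ x₃ := by
  obtain ⟨h1, h2⟩ := filter_candidateWord x₁ x₂ x₃
  have h3 : (candidateWord x₁ x₂ x₃).filter (fun v => ! decide (v ∈ firstKept x₁ x₂)) =
      (word x₃).filter (fun v => ! decide (v ∈ firstKept x₁ x₂)) := by
    have := congrArg (List.filter fun v => ! decide (v ∈ firstKept x₁ x₂)) h2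
    rw [List.filter_filter, List.filter_filter] at this
    convert this using 2 <;>
    · ext v
      by_cases hv : v ∈ firstKept x₁ x₂ <;> simp [hv]
  have h4 : ((word x₃).filter (· ∈ firstKept x₁ x₂)).Perm (firstKept x₁ x₂) := by
    refine (List.perm_ext_iff_of_nodup ((nodup_word x₃).sublist List.filter_sublist)
      (nodup_of_pairwise_lt (firstKept_spec x₁ x₂).1)).2 fun a => ?_
    simp [mem_word]
  have hperm : (candidateWord x₁ x₂ x₃).Perm (word x₃) := by
    have e1 := List.filter_append_perm (fun v => decide (v ∈ firstKept x₁ x₂))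
      (candidateWord x₁ x₂ x₃)
    have e2 := List.filter_append_perm (fun v => decide (v ∈ firstKept x₁ x₂)) (word x₃)
    rw [h1, h3] at e1
    exact e1.symm.trans ((h4.symm.append_right _).trans e2)
  exact exists_word_eq (hperm.nodup_iff.2 (nodup_word x₃)) (hperm.length_eq.trans (length_word x₃))

/-- The candidate center computed from three samples. -/
noncomputable def candidate (x₁ x₂ x₃ : Equiv.Perm (Fin d)) : Equiv.Perm (Fin d) :=
  (exists_word_eq_candidateWord x₁ x₂ x₃).choose

theorem word_candidate (x₁ x₂ x₃ : Equiv.Perm (Fin d)) :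
    word (candidate x₁ x₂ x₃) = candidateWord x₁ x₂ x₃ :=
  (exists_word_eq_candidateWord x₁ x₂ x₃).choose_spec

/-- The candidate has the order of `x₁` on `firstKept x₁ x₂`, and otherwise that of `x₃`; hence it
has the order of a center `x₀` off the bad symbols. -/
theorem agreeOff_candidate {x₀ x₁ x₂ x₃ : Equiv.Perm (Fin d)} {I₁ I₂ I₃ : Finset (Fin d)}
    (h1 : AgreeOff univ I₁ (rank x₀) (rank x₁)) (h2 : AgreeOff univ I₂ (rank x₀) (rank x₂))
    (h3 : AgreeOff univ I₃ (rank x₀) (rank x₃)) :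
    AgreeOff univ (finalBad (rank x₀) (rank x₁) (firstKept x₁ x₂).toFinset
      (firstBad (rank x₀) (rank x₁) I₁ I₂) I₃) (rank x₀) (rank (candidate x₁ x₂ x₃)) := by
  obtain ⟨hs, π, hπ⟩ := firstKept_spec x₁ x₂
  obtain ⟨-, -, π', hπ'⟩ := secondKept_spec x₁ x₂ x₃
  obtain ⟨f1, f2⟩ := filter_candidateWord x₁ x₂ x₃
  have hw := pairwise_rank_word (candidate x₁ x₂ x₃)
  rw [word_candidate] at hw
  refine agreeOff_finalBad (rank_injective _) (rank_injective _) (rank_injective _)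
    (agreeOff_firstBad (rank_injective _) (rank_injective _) (rank_injective _) h1 h2 hπ) h3 hπ'
    ?_ ?_
  · intro u hu v hv _ _
    have := hw.sublist (List.filter_sublist (p := fun v => decide (v ∈ firstKept x₁ x₂)))
    rw [f1] at this
    exact lt_iff_lt_of_pairwise this hs (by simpa using hu) (by simpa using hv)
  · intro u hu v hv _ _
    have e1 := hw.sublist (List.filter_sublist
      (p := fun v => decide (v ∉ firstKept x₁ x₂ ∨ v ∈ secondKept x₁ x₂ x₃)))
    have e2 := (pairwise_rank_word x₃).sublist (List.filter_sublist
      (p := fun v => decide (v ∉ firstKept x₁ x₂ ∨ v ∈ secondKept x₁ x₂ x₃)))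
    rw [f2] at e1
    refine lt_iff_lt_of_pairwise e1 e2 ?_ ?_
    · rw [List.mem_filter]
      refine ⟨mem_word _ _, ?_⟩
      simp at hu ⊢
      tauto
    · rw [List.mem_filter]
      refine ⟨mem_word _ _, ?_⟩
      simp at hv ⊢
      tauto

theorem card_compl_firstKept_le {x₀ x₁ x₂ : Equiv.Perm (Fin d)} {I₁ I₂ : Finset (Fin d)}
    (h1 : AgreeOff univ I₁ (rank x₀) (rank x₁)) (h2 : AgreeOff univ I₂ (rank x₀) (rank x₂)) :
    #(univ \ (firstKept x₁ x₂).toFinset) ≤ 2 * (#I₁ + #I₂) := by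
  obtain ⟨-, π, hπ⟩ := firstKept_spec x₁ x₂
  have hI : AgreeOff univ (I₁ ∪ I₂) (rank x₁) (rank x₂) := by
    intro u _ v _ hu hv
    rw [mem_union, not_or] at hu hv
    exact (h1 u (mem_univ _) v (mem_univ _) hu.1 hv.1).symm.trans
      (h2 u (mem_univ _) v (mem_univ _) hu.2 hv.2)
  have h := hπ.card_le (K := univ \ (firstKept x₁ x₂).toFinset) hI (subset_univ _)
    (fun u hu hL => absurd hL (mem_sdiff.1 hu).2)
    (fun u hu hL => mem_sdiff.2 ⟨mem_univ _, (hπ.maps u (mem_univ _) hL).2⟩)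
  have e1 : #((univ \ (firstKept x₁ x₂).toFinset) ∩ (I₁ ∪ I₂)) ≤ #(I₁ ∪ I₂) :=
    card_le_card inter_subset_right
  have e2 := card_union_le I₁ I₂
  omega

end Order
end UlamMedian

namespace UlamMedian

/-! ### Total correctness of word RAM programs -/


section Logic

/-- Started in the store `s`, the program `P` makes no random choices and ends in the store `s'`
after exactly `t` steps. -/
def Exec (w : ℕ) (P : Prog) (s s' : Store) (t : ℕ) : Prop :=
  ∀ k n, runSteps w (t + n) ⟨P :: k, s⟩ = runSteps w n ⟨k, s'⟩

/-- Total correctness with a time bound: started in `s`, the program `P` ends deterministically,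
within `t` steps, in a store that satisfies `Q`. -/
def Tot (w : ℕ) (P : Prog) (s : Store) (t : ℕ) (Q : Store → Prop) : Prop :=
  ∃ s' t', t' ≤ t ∧ Exec w P s s' t' ∧ Q s'

variable {w : ℕ} {P P' : Prog} {s s' : Store} {t t₁ t₂ : ℕ} {Q R : Store → Prop}

theorem Exec.of_step {c : Config} (h : ∀ k, step w ⟨P :: k, s⟩ = PMF.pure ⟨c.todo ++ k, c.store⟩)
    (h' : ∀ k n, runSteps w (t + n) ⟨c.todo ++ k, c.store⟩ = runSteps w n ⟨k, s'⟩) :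
    Exec w P s s' (t + 1) := by
  intro k n
  rw [show t + 1 + n = (t + n) + 1 by ring, runSteps, h, PMF.pure_bind, h']

theorem Tot.imp (h : Tot w P s t Q) (hQ : ∀ s', Q s' → R s') : Tot w P s t R := by
  obtain ⟨s', t', ht, he, hq⟩ := h
  exact ⟨s', t', ht, he, hQ s' hq⟩

theorem Tot.le (h : Tot w P s t₁ Q) (ht : t₁ ≤ t₂) : Tot w P s t₂ Q := by
  obtain ⟨s', t', ht', he, hq⟩ := h
  exact ⟨s', t', ht'.trans ht, he, hq⟩

theorem tot_assign {r : ℕ} {e : Expr} (h : Q (s.setReg r (e.eval w s))) :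
    Tot w (.assign r e) s (t + 1) Q :=
  ⟨_, 1, by omega, Exec.of_step (t := 0) (c := ⟨[], s.setReg r (e.eval w s)⟩) (fun _ => rfl)
    (fun k n => by simp), h⟩

theorem tot_store {a e : Expr} (h : Q (s.setMem (a.eval w s) (e.eval w s))) :
    Tot w (.store a e) s (t + 1) Q :=
  ⟨_, 1, by omega, Exec.of_step (t := 0) (c := ⟨[], s.setMem (a.eval w s) (e.eval w s)⟩)
    (fun _ => rfl) (fun k n => by simp), h⟩

theorem tot_seq (h : Tot w P s t₁ fun s' => Tot w P' s' t₂ Q) :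
    Tot w (.seq P P') s (t₁ + t₂ + 1) Q := by
  obtain ⟨s₁, u₁, hu₁, h₁, s₂, u₂, hu₂, h₂, hq⟩ := h
  refine ⟨s₂, u₁ + u₂ + 1, by omega, Exec.of_step (c := ⟨[P, P'], s⟩) (fun _ => rfl) ?_, hq⟩
  intro k n
  rw [add_assoc]
  exact (h₁ _ _).trans (h₂ _ _)

theorem tot_ite {e : Expr} (h₁ : e.eval w s ≠ 0 → Tot w P s t Q)
    (h₂ : e.eval w s = 0 → Tot w P' s t Q) : Tot w (.ite e P P') s (t + 1) Q := by
  by_cases he : e.eval w s = 0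
  · obtain ⟨s', u, hu, h, hq⟩ := h₂ he
    exact ⟨s', u + 1, by omega, Exec.of_step (c := ⟨[P'], s⟩) (fun k => by simp [step, he]) h, hq⟩
  · obtain ⟨s', u, hu, h, hq⟩ := h₁ he
    exact ⟨s', u + 1, by omega, Exec.of_step (c := ⟨[P], s⟩) (fun k => by simp [step, he]) h, hq⟩

/-- The rule for loops: `Inv n` is the invariant when at most `n` rounds are left. -/
theorem tot_while {e : Expr} (Inv : ℕ → Store → Prop)
    (h : ∀ n s, Inv n s → (e.eval w s = 0 ∧ Q s) ∨
      (e.eval w s ≠ 0 ∧ Tot w P s t fun s' => ∃ m < n, Inv m s')) :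
    ∀ n s, Inv n s → Tot w (.while e P) s (n * (t + 1) + 1) Q := by
  intro n
  induction n using Nat.strong_induction_on with
  | _ n ih =>
    intro s hs
    rcases h n s hs with ⟨he, hq⟩ | ⟨he, s₁, u₁, hu₁, h₁, m, hm, hinv⟩
    · exact ⟨s, 1, by omega, Exec.of_step (t := 0) (c := ⟨[], s⟩) (fun k => by simp [step, he])
        (fun k n => by simp), hq⟩
    · obtain ⟨s₂, u₂, hu₂, h₂, hq⟩ := ih m hm s₁ hinv
      refine ⟨s₂, u₁ + u₂ + 1, ?_, Exec.of_step (c := ⟨[P, .while e P], s⟩)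
        (fun k => by simp [step, he]) ?_, hq⟩
      · have : (m + 1) * (t + 1) ≤ n * (t + 1) := Nat.mul_le_mul_right _ hm
        rw [add_mul] at this
        omega
      · intro k n
        rw [add_assoc]
        exact (h₁ _ _).trans (h₂ _ _)

theorem tot_assign_seq {r : ℕ} {e : Expr} (h : Tot w P (s.setReg r (e.eval w s)) t Q) :
    Tot w (.seq (.assign r e) P) s (t + 2) Q :=
  (tot_seq (t₁ := 1) (t₂ := t) (tot_assign (t := 0) h)).le (by omega)

theorem tot_store_seq {a e : Expr} (h : Tot w P (s.setMem (a.eval w s) (e.eval w s)) t Q) :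
    Tot w (.seq (.store a e) P) s (t + 2) Q :=
  (tot_seq (t₁ := 1) (t₂ := t) (tot_store (t := 0) h)).le (by omega)

theorem runSteps_nil (w n : ℕ) (s : Store) : runSteps w n ⟨[], s⟩ = PMF.pure ⟨[], s⟩ := by
  induction n with
  | zero => rfl
  | succ n ih => rw [runSteps, step, PMF.pure_bind, ih]

theorem Tot.runSteps_eq (h : Tot w P s t Q) :
    ∃ s', Q s' ∧ runSteps w t ⟨[P], s⟩ = PMF.pure ⟨[], s'⟩ := by
  obtain ⟨s', u, hu, h, hq⟩ := h
  refine ⟨s', hq, ?_⟩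
  obtain ⟨n, rfl⟩ := Nat.exists_eq_add_of_le hu
  rw [h, runSteps_nil]

theorem Store.reg_setReg (s : Store) (r v r' : ℕ) :
    (s.setReg r v).reg r' = if r' = r then v else s.reg r' := by
  simp [Store.setReg, Function.update_apply]

theorem Store.mem_setReg (s : Store) (r v a : ℕ) : (s.setReg r v).mem a = s.mem a := rfl

theorem Store.reg_setMem (s : Store) (a v r : ℕ) : (s.setMem a v).reg r = s.reg r := rfl

theorem Store.mem_setMem (s : Store) (a v a' : ℕ) :
    (s.setMem a v).mem a' = if a' = a then v else s.mem a' := by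
  simp [Store.setMem, Function.update_apply]

end Logic

section Evaluation

variable {w : ℕ} {s : Store} {a b : Expr} {x y r : ℕ}

theorem eval_lit {n : ℕ} (h : n < 2 ^ w) : (Expr.lit n).eval w s = n := Nat.mod_eq_of_lt h

theorem eval_reg (h : s.reg r = x) : (Expr.reg r).eval w s = x := h

theorem eval_load (h : a.eval w s = x) : (Expr.load a).eval w s = s.mem x := by
  rw [Expr.eval, h]

theorem eval_add (ha : a.eval w s = x) (hb : b.eval w s = y) (h : x + y < 2 ^ w) :
    (Expr.add a b).eval w s = x + y := by
  rw [Expr.eval, ha, hb, Nat.mod_eq_of_lt h]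

theorem eval_sub (ha : a.eval w s = x) (hb : b.eval w s = y) :
    (Expr.sub a b).eval w s = x - y := by
  rw [Expr.eval, ha, hb]

theorem eval_mul (ha : a.eval w s = x) (hb : b.eval w s = y) (h : x * y < 2 ^ w) :
    (Expr.mul a b).eval w s = x * y := by
  rw [Expr.eval, ha, hb, Nat.mod_eq_of_lt h]

theorem eval_lt (ha : a.eval w s = x) (hb : b.eval w s = y) :
    (Expr.lt a b).eval w s = if x < y then 1 else 0 := by
  rw [Expr.eval, ha, hb]

theorem eval_eq (ha : a.eval w s = x) (hb : b.eval w s = y) :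
    (Expr.eq a b).eval w s = if x = y then 1 else 0 := by
  rw [Expr.eval, ha, hb]

end Evaluation

section Subroutines

variable {d w : ℕ}

/-- The memory holds the string `l` from the address `b` on. -/
def Holds (m : ℕ → ℕ) (b : ℕ) (l : List (Fin d)) : Prop :=
  ∀ i (h : i < l.length), m (b + i) = (l[i] : ℕ)

/-- Writes, for each symbol of the string at the address in register `1`, whose length is in
register `2`, its position plus one to the cell of this symbol in the array at the address in
register `3`. The value `0` is left to the symbols that do not occur. -/
def scatterProg : Prog :=
  .seq (.assign 4 (.lit 0))
    (.while (.lt (.reg 4) (.reg 2))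
      (.seq (.store (.add (.reg 3) (.load (.add (.reg 1) (.reg 4)))) (.add (.reg 4) (.lit 1)))
        (.assign 4 (.add (.reg 4) (.lit 1)))))

theorem tot_scatterProg {s : Store} {l : List (Fin d)} {src dst : ℕ} (h1 : s.reg 1 = src)
    (h2 : s.reg 2 = l.length) (h3 : s.reg 3 = dst) (hl : Holds s.mem src l) (hnd : l.Nodup)
    (hlen : l.length ≤ d)
    (hdisj : src + l.length ≤ dst ∨ dst + d ≤ src) (hw : src + d < 2 ^ w)
    (hw' : dst + d < 2 ^ w) :
    Tot w scatterProg s (10 * d + 10) fun s' =>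
      (∀ u : Fin d, s'.mem (dst + u) = if u ∈ l then l.idxOf u + 1 else s.mem (dst + u)) ∧
      (∀ a, a < dst ∨ dst + d ≤ a → s'.mem a = s.mem a) ∧ ∀ r, r ≠ 4 → s'.reg r = s.reg r := by
  have hW0 : 0 < 2 ^ w := Nat.two_pow_pos w
  refine Tot.le (tot_assign_seq (t := l.length * (5 + 1) + 1) (tot_while (fun n s' =>
    n = l.length - s'.reg 4 ∧ s'.reg 4 ≤ l.length ∧
    (∀ u : Fin d, s'.mem (dst + u) =
      if u ∈ l.take (s'.reg 4) then l.idxOf u + 1 else s.mem (dst + u)) ∧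
    (∀ a, a < dst ∨ dst + d ≤ a → s'.mem a = s.mem a) ∧ ∀ r, r ≠ 4 → s'.reg r = s.reg r)
    ?_ _ _ ?_)) (by omega)
  · rintro n s' ⟨hn, hi, hm, hfr, hr⟩
    have e1 : s'.reg 1 = src := by rw [hr 1 (by norm_num), h1]
    have e2 : s'.reg 2 = l.length := by rw [hr 2 (by norm_num), h2]
    have e3 : s'.reg 3 = dst := by rw [hr 3 (by norm_num), h3]
    generalize hie : s'.reg 4 = i at *
    by_cases hlt : i < l.length
    · right
      refine ⟨by simp [Expr.eval, e2, hie, hlt], ?_⟩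
      have ha : s'.mem (src + i) = (l[i] : ℕ) := by
        rw [hfr _ (by omega), hl i hlt]
      have hli := (l[i]).isLt
      refine tot_store_seq (t := 3) (tot_assign ?_)
      have ev : (Expr.add (.reg 3) (.load (.add (.reg 1) (.reg 4)))).eval w s' = dst + l[i] := by
        simp only [Expr.eval, e1, e3, hie]
        rw [Nat.mod_eq_of_lt (a := src + i) (by omega), ha, Nat.mod_eq_of_lt (by omega)]
      have ei : (Expr.add (.reg 4) (.lit 1)).eval w s' = i + 1 := by
        simp only [Expr.eval, hie]
        rw [Nat.mod_eq_of_lt (a := 1) (by omega), Nat.mod_eq_of_lt (by omega)]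
      have ei' : (Expr.add (.reg 4) (.lit 1)).eval w (s'.setMem (dst + l[i]) (i + 1)) = i + 1 := by
        simpa only [Expr.eval, Store.reg_setMem] using ei
      rw [ev, ei, ei']
      refine ⟨l.length - (i + 1), by omega, ?_⟩
      refine ⟨by simp [Store.reg_setReg], by simp [Store.reg_setReg]; omega, ?_, ?_, ?_⟩
      · intro u
        have htake : u ∈ l.take (i + 1) ↔ u ∈ l.take i ∨ u = l[i] := by
          rw [show l.take (i + 1) = l.take i ++ [l[i]] by
            rw [List.take_add_one, List.getElem?_eq_getElem hlt]; rfl, List.mem_append,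
            List.mem_singleton]
        simp only [Store.reg_setReg, Store.mem_setReg, Store.mem_setMem, if_true,
          Nat.add_left_cancel_iff, htake]
        by_cases hu : u = l[i]
        · subst hu
          simp [List.Nodup.idxOf_getElem hnd]
        · have hu' : (u : ℕ) ≠ l[i] := fun h => hu (Fin.ext h)
          simp only [hu, hu', or_false, if_false]
          exact hm u
      · intro a ha
        rw [Store.mem_setReg, Store.mem_setMem, if_neg (by omega), hfr a ha]
      · intro r hr4
        rw [Store.reg_setReg, if_neg hr4, Store.reg_setMem, hr r hr4]
    · left
      refine ⟨by simp [Expr.eval, e2, hie, hlt], ?_, hfr, hr⟩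
      have : i = l.length := by omega
      subst this
      simpa using hm
  · refine ⟨?_, ?_, ?_, ?_, ?_⟩
    · simp [Store.reg_setReg, Expr.eval]
    · simp [Store.reg_setReg, Expr.eval]
    · simp [Store.reg_setReg, Store.mem_setReg, Expr.eval]
    · intro a _
      rfl
    · intro r hr
      rw [Store.reg_setReg, if_neg hr]

theorem Holds.of_append_left {m : ℕ → ℕ} {b : ℕ} {l l' : List (Fin d)}
    (h : Holds m b (l ++ l')) : Holds m b l := by
  intro i hi
  rw [h i (by rw [List.length_append]; omega), List.getElem_append_left hi]

theorem Holds.congr {m m' : ℕ → ℕ} {b : ℕ} {l : List (Fin d)} (h : Holds m b l)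
    (hm : ∀ a, b ≤ a → a < b + l.length → m' a = m a) : Holds m' b l := by
  intro i hi
  rw [hm _ (by omega) (by omega), h i hi]

theorem Holds.concat {m m' : ℕ → ℕ} {b : ℕ} {l : List (Fin d)} {v : Fin d} (h : Holds m b l)
    (hv : m' (b + l.length) = v) (hm : ∀ a, a ≠ b + l.length → m' a = m a) :
    Holds m' b (l ++ [v]) := by
  intro i hi
  rw [List.length_append, List.length_singleton] at hi
  rcases (Nat.lt_succ_iff.1 hi).eq_or_lt with rfl | hlt
  · simpa using hv
  · rw [List.getElem_append_left hlt, hm _ (by omega), h i hlt]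

theorem length_stackRun_le {V : Type*} (q : V → ℕ) (P : List V) :
    (stackRun q P).length ≤ P.length := by
  induction P using List.reverseRecOn with
  | nil => simp [stackRun]
  | append_singleton P s ih =>
    rw [stackRun_append_singleton, List.length_append, List.length_singleton]
    generalize stackRun q P = st at ih ⊢
    rcases st with _ | ⟨t, r⟩
    · simp [stackStep]
    · rw [List.length_cons] at ih
      rw [stackStep]
      split_ifs
      · omega
      · simp only [List.length_cons]
        omega

/-- The greedy removal of inversions: the string at the address in register `1`, whose length is in
register `2`, is processed with the keys in the array at the address in register `3`, and the stack
is built up at the address in register `5`, with its length in register `6`. The top of an empty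
stack is a meaningless value; it is read, but then the first factor of the condition is `0`. -/
def stackProg : Prog :=
  .seq (.assign 4 (.lit 0)) (.seq (.assign 6 (.lit 0))
    (.while (.lt (.reg 4) (.reg 2))
      (.seq (.assign 7 (.load (.add (.reg 1) (.reg 4))))
        (.seq (.assign 4 (.add (.reg 4) (.lit 1)))
          (.ite (.mul (.lt (.lit 0) (.reg 6)) (.lt (.load (.add (.reg 3) (.reg 7)))
              (.load (.add (.reg 3) (.load (.add (.reg 5) (.sub (.reg 6) (.lit 1))))))))
            (.assign 6 (.sub (.reg 6) (.lit 1)))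
            (.seq (.store (.add (.reg 5) (.reg 6)) (.reg 7))
              (.assign 6 (.add (.reg 6) (.lit 1)))))))))

theorem tot_stackProg {s : Store} {l : List (Fin d)} {q : Fin d → ℕ} {src key dst : ℕ}
    (h1 : s.reg 1 = src) (h2 : s.reg 2 = l.length) (h3 : s.reg 3 = key) (h5 : s.reg 5 = dst)
    (hl : Holds s.mem src l) (hlen : l.length ≤ d) (hq : ∀ u : Fin d, s.mem (key + u) = q u + 1)
    (hdisj : src + l.length ≤ dst ∨ dst + d ≤ src) (hdisj' : key + d ≤ dst ∨ dst + d ≤ key)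
    (hw : src + d < 2 ^ w) (hw' : dst + d < 2 ^ w) (hw'' : key + d < 2 ^ w) :
    Tot w stackProg s (20 * d + 20) fun s' =>
      s'.reg 6 = (stackRun q l).length ∧ Holds s'.mem dst (stackRun q l).reverse ∧
      (∀ a, a < dst ∨ dst + d ≤ a → s'.mem a = s.mem a) ∧
      ∀ r, r ≠ 4 → r ≠ 6 → r ≠ 7 → s'.reg r = s.reg r := by
  refine Tot.le (tot_assign_seq (tot_assign_seq (t := l.length * (12 + 1) + 1)
    (tot_while (fun n s' =>
    n = l.length - s'.reg 4 ∧ s'.reg 4 ≤ l.length ∧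
    s'.reg 6 = (stackRun q (l.take (s'.reg 4))).length ∧
    Holds s'.mem dst (stackRun q (l.take (s'.reg 4))).reverse ∧
    (∀ a, a < dst ∨ dst + d ≤ a → s'.mem a = s.mem a) ∧
    ∀ r, r ≠ 4 → r ≠ 6 → r ≠ 7 → s'.reg r = s.reg r)
    ?_ _ _ ?_))) (by omega)
  · rintro n s' ⟨hn, hi, h6, hst, hfr, hr⟩
    have e1 : s'.reg 1 = src := by rw [hr 1 (by norm_num) (by norm_num) (by norm_num), h1]
    have e2 : s'.reg 2 = l.length := by rw [hr 2 (by norm_num) (by norm_num) (by norm_num), h2]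
    have e3 : s'.reg 3 = key := by rw [hr 3 (by norm_num) (by norm_num) (by norm_num), h3]
    have e5 : s'.reg 5 = dst := by rw [hr 5 (by norm_num) (by norm_num) (by norm_num), h5]
    generalize hie : s'.reg 4 = i at *
    by_cases hlt : i < l.length
    · right
      refine ⟨by simp [Expr.eval, e2, hie, hlt], ?_⟩
      set v := l[i] with hv
      have ha : s'.mem (src + i) = (v : ℕ) := by
        rw [hfr _ (by omega), hl i hlt]
      have hvd := v.isLt
      have hq' : ∀ u : Fin d, s'.mem (key + u) = q u + 1 := fun u => by
        have := u.isLt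
        rw [hfr _ (by omega), hq]
      have htake : l.take (i + 1) = l.take i ++ [v] := by
        rw [List.take_add_one, List.getElem?_eq_getElem hlt]
        rfl
      have hstep := stackRun_append_singleton q (l.take i) v
      rw [← htake] at hstep
      have hle := length_stackRun_le q (l.take i)
      rw [List.length_take] at hle
      generalize hstk : stackRun q (l.take i) = st at *
      have ev7 : (Expr.load (.add (.reg 1) (.reg 4))).eval w s' = v := by
        rw [eval_load (eval_add (eval_reg e1) (eval_reg hie) (by omega)), ha]
      refine tot_assign_seq ?_
      rw [ev7]
      have ev4 : (Expr.add (.reg 4) (.lit 1)).eval w (s'.setReg 7 v) = i + 1 :=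
        eval_add (eval_reg (by simp [Store.reg_setReg, hie])) (eval_lit (by omega)) (by omega)
      refine tot_assign_seq ?_
      rw [ev4]
      set s₂ := (s'.setReg 7 v).setReg 4 (i + 1) with hs₂
      have f3 : s₂.reg 3 = key := by simp [hs₂, Store.reg_setReg, e3]
      have f4 : s₂.reg 4 = i + 1 := by simp [hs₂, Store.reg_setReg]
      have f5 : s₂.reg 5 = dst := by simp [hs₂, Store.reg_setReg, e5]
      have f6 : s₂.reg 6 = st.length := by simp [hs₂, Store.reg_setReg, h6]
      have f7 : s₂.reg 7 = v := by simp [hs₂, Store.reg_setReg]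
      have fm : s₂.mem = s'.mem := rfl
      have fr : ∀ r, r ≠ 4 → r ≠ 6 → r ≠ 7 → s₂.reg r = s.reg r := fun r h4 h6 h7 => by
        simp only [hs₂, Store.reg_setReg, h4, h7, if_false]
        exact hr r h4 h6 h7
      clear_value s₂
      have hpush : stackStep q st v = v :: st →
          Tot w (.seq (.store (.add (.reg 5) (.reg 6)) (.reg 7))
            (.assign 6 (.add (.reg 6) (.lit 1)))) s₂ 7 fun s' => ∃ m < n, m = l.length - s'.reg 4 ∧
              s'.reg 4 ≤ l.length ∧ s'.reg 6 = (stackRun q (l.take (s'.reg 4))).length ∧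
              Holds s'.mem dst (stackRun q (l.take (s'.reg 4))).reverse ∧
              (∀ a, a < dst ∨ dst + d ≤ a → s'.mem a = s.mem a) ∧
              ∀ r, r ≠ 4 → r ≠ 6 → r ≠ 7 → s'.reg r = s.reg r := by
        intro hp
        refine tot_store_seq (tot_assign ?_)
        rw [eval_add (eval_reg f5) (eval_reg f6) (by omega), eval_reg f7,
          eval_add (s := s₂.setMem (dst + st.length) v) (x := st.length) (eval_reg f6)
            (eval_lit (n := 1) (by omega)) (by omega)]
        refine ⟨l.length - (i + 1), by omega, ?_⟩
        simp only [Store.reg_setReg, Store.reg_setMem, Nat.reduceEqDiff, if_false, if_true, f4,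
          hstep, hp]
        refine ⟨trivial, hlt, by simp, ?_, ?_, ?_⟩
        · rw [List.reverse_cons]
          refine hst.concat ?_ ?_
          · simp [Store.mem_setReg, Store.mem_setMem]
          · intro a ha
            rw [List.length_reverse] at ha
            rw [Store.mem_setReg, Store.mem_setMem, if_neg ha, fm]
        · intro a ha
          rw [Store.mem_setReg, Store.mem_setMem, if_neg (by omega), fm, hfr a ha]
        · intro r h4 h6 h7
          rw [if_neg h6, fr r h4 h6 h7]
      refine tot_ite ?_ ?_
      · intro hne
        rcases st with _ | ⟨t, r⟩
        · simp [Expr.eval, f6] at hne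
        · rw [List.length_cons] at f6 hle
          have htop : s₂.mem (dst + r.length) = (t : ℕ) := by
            rw [fm, hst r.length (by simp)]
            simp
          have htd := t.isLt
          have hqlt : q v < q t := by
            by_contra hn
            apply hne
            rw [Expr.eval, eval_lt (eval_load (eval_add (eval_reg f3) (eval_reg f7) (by omega)))
              (eval_load (eval_add (eval_reg f3) (eval_load (eval_add (eval_reg f5)
                (eval_sub (eval_reg f6) (eval_lit (n := 1) (by omega)))
                (by omega))) (by rw [Nat.add_sub_cancel, htop]; omega))),
              Nat.add_sub_cancel, htop, fm, hq', hq', if_neg (by omega)]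
            simp
          refine tot_assign ?_
          rw [eval_sub (eval_reg f6) (eval_lit (n := 1) (by omega)), Nat.add_sub_cancel]
          refine ⟨l.length - (i + 1), by omega, ?_⟩
          have hp : stackStep q (t :: r) v = r := by rw [stackStep, if_pos hqlt]
          simp only [Store.reg_setReg, Nat.reduceEqDiff, if_false, if_true, f4, hstep, hp]
          refine ⟨trivial, hlt, by simp, ?_, ?_, ?_⟩
          · rw [List.reverse_cons] at hst
            exact hst.of_append_left.congr fun a _ _ => by rw [Store.mem_setReg, fm]
          · intro a ha
            rw [Store.mem_setReg, fm, hfr a ha]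
          · intro r h4 h6 h7
            rw [if_neg h6, fr r h4 h6 h7]
      · intro heq
        refine hpush ?_
        rcases st with _ | ⟨t, r⟩
        · rfl
        · rw [List.length_cons] at f6 hle
          have htop : s₂.mem (dst + r.length) = (t : ℕ) := by
            rw [fm, hst r.length (by simp)]
            simp
          have htd := t.isLt
          rw [stackStep, if_neg]
          intro hqlt
          rw [eval_mul (eval_lt (eval_lit (by omega)) (eval_reg f6))
            (eval_lt (eval_load (eval_add (eval_reg f3) (eval_reg f7) (by omega)))
              (eval_load (eval_add (eval_reg f3) (eval_load (eval_add (eval_reg f5)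
                (eval_sub (eval_reg f6) (eval_lit (n := 1) (by omega)))
                (by omega))) (by rw [Nat.add_sub_cancel, htop]; omega)))),
              Nat.add_sub_cancel, htop, fm, hq', hq', if_pos (by omega), if_pos (by omega)] at heq
          · exact absurd heq (by norm_num)
          · split_ifs <;> omega
    · left
      have : i = l.length := by omega
      subst this
      rw [List.take_length] at h6 hst
      exact ⟨by simp [Expr.eval, e2, hie], h6, hst, hfr, hr⟩
  · simp only [Store.reg_setReg, Store.mem_setReg, Expr.eval, Nat.zero_mod]
    refine ⟨rfl, by simp, by simp [stackRun], ?_, ?_, ?_⟩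
    · intro i hi
      simp [stackRun] at hi
    · intro a _
      trivial
    · intro r h4 h6 _
      simp [h4, h6]

end Subroutines
end UlamMedian

namespace UlamMedian

/-! ### The program that inserts symbols -/


section Weaving

variable {d w : ℕ}

/-- Copies the next symbol of the string at the address in register `17` to the output. -/
def copyProg : Prog :=
  .seq (.store (.reg 13) (.load (.add (.reg 17) (.reg 6))))
    (.seq (.assign 13 (.add (.reg 13) (.lit 1))) (.assign 6 (.add (.reg 6) (.lit 1))))

/-- The function `weave`: the string of length `d` at the address in register `8` is merged with the
string at the address in register `17`, whose length is in register `21`. The arrays at the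
addresses in registers `19` and `20` are nonzero at the symbols of `A` and of `A'`. Register `13`
points to the end of the output. -/
def weaveProg : Prog :=
  .seq (.assign 4 (.lit 0)) (.seq (.assign 6 (.lit 0))
    (.seq
      (.while (.lt (.reg 4) (.reg 0))
        (.seq (.assign 7 (.load (.add (.reg 8) (.reg 4))))
          (.ite (.load (.add (.reg 19) (.reg 7)))
            (.ite (.load (.add (.reg 20) (.reg 7)))
              (.seq (.assign 23 (.eq (.load (.add (.reg 17) (.reg 6))) (.reg 7)))
                (.seq (.assign 4 (.add (.reg 4) (.reg 23))) copyProg))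
              (.assign 4 (.add (.reg 4) (.lit 1))))
            (.seq (.store (.reg 13) (.reg 7))
              (.seq (.assign 13 (.add (.reg 13) (.lit 1)))
                (.assign 4 (.add (.reg 4) (.lit 1))))))))
      (.while (.lt (.reg 6) (.reg 21)) copyProg)))

/-- The registers that `weaveProg` uses for its own purposes. -/
def IsScratch (r : ℕ) : Prop := r = 4 ∨ r = 6 ∨ r = 7 ∨ r = 13 ∨ r = 23

/-- The output `o` stands at the address `out`, nothing else than the output array has changed since
`s`, and `a` symbols of the second string have been used. -/
structure WeaveInv (s : Store) (out a : ℕ) (o : List (Fin d)) (s' : Store) : Prop where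
  holds : Holds s'.mem out o
  ptr : s'.reg 13 = out + o.length
  used : s'.reg 6 = a
  mem : ∀ b, b < out ∨ out + d ≤ b → s'.mem b = s.mem b
  reg : ∀ r, ¬ IsScratch r → s'.reg r = s.reg r

theorem tot_copyProg {s s' : Store} {out a lsb t : ℕ} {o A : List (Fin d)} {Q : Store → Prop}
    (h : WeaveInv s out a o s') (h17 : s'.reg 17 = lsb) (hA : Holds s'.mem lsb A)
    (ha : a < A.length) (ho : o.length < d) (hAd : A.length ≤ d) (hw : out + d < 2 ^ w)
    (hw' : lsb + d < 2 ^ w)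
    (hQ : ∀ s'', WeaveInv s out (a + 1) (o ++ [A[a]]) s'' → s''.reg 4 = s'.reg 4 → Q s'') :
    Tot w copyProg s' (t + 5) Q := by
  have e1 : (Expr.load (.add (.reg 17) (.reg 6))).eval w s' = A[a] := by
    rw [eval_load (eval_add (eval_reg h17) (eval_reg h.used) (by omega)), hA a ha]
  refine tot_store_seq (tot_assign_seq (tot_assign ?_))
  rw [eval_reg h.ptr, e1]
  rw [eval_add (s := s'.setMem (out + o.length) A[a]) (eval_reg h.ptr)
    (eval_lit (n := 1) (by omega)) (by omega)]
  rw [eval_add (s := (s'.setMem (out + o.length) A[a]).setReg 13 (out + o.length + 1))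
    (eval_reg (r := 6) (x := a) h.used) (eval_lit (n := 1) (by omega)) (by omega)]
  refine hQ _ ⟨?_, ?_, ?_, ?_, ?_⟩ ?_
  · refine h.holds.concat ?_ ?_
    · simp [Store.mem_setReg, Store.mem_setMem]
    · intro b hb
      rw [Store.mem_setReg, Store.mem_setReg, Store.mem_setMem, if_neg hb]
  · simp [Store.reg_setReg, add_assoc]
  · simp [Store.reg_setReg]
  · intro b hb
    rw [Store.mem_setReg, Store.mem_setReg, Store.mem_setMem, if_neg (by omega), h.mem b hb]
  · intro r hr
    have h6 : r ≠ 6 := fun h => hr (by simp [IsScratch, h])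
    have h13 : r ≠ 13 := fun h => hr (by simp [IsScratch, h])
    rw [Store.reg_setReg, if_neg h6, Store.reg_setReg, if_neg h13, Store.reg_setMem, h.reg r hr]
  · simp [Store.reg_setReg, Store.reg_setMem]

theorem tot_weaveProg {s : Store} {xs A A' : List (Fin d)} {src lsb f₁ f₂ out : ℕ}
    (h0 : s.reg 0 = d) (h8 : s.reg 8 = src) (h17 : s.reg 17 = lsb) (h19 : s.reg 19 = f₁)
    (h20 : s.reg 20 = f₂) (h21 : s.reg 21 = A.length) (h13 : s.reg 13 = out)
    (hxs : Holds s.mem src xs) (hxd : xs.length = d) (hA : Holds s.mem lsb A) (hAd : A.length ≤ d)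
    (hf₁ : ∀ u : Fin d, s.mem (f₁ + u) ≠ 0 ↔ u ∈ A)
    (hf₂ : ∀ u : Fin d, s.mem (f₂ + u) ≠ 0 ↔ u ∈ A')
    (hsrc : src + d ≤ out ∨ out + d ≤ src) (hlsb : lsb + d ≤ out ∨ out + d ≤ lsb)
    (hd₁ : f₁ + d ≤ out ∨ out + d ≤ f₁) (hd₂ : f₂ + d ≤ out ∨ out + d ≤ f₂)
    (hws : src + d < 2 ^ w) (hwl : lsb + d < 2 ^ w) (hw₁ : f₁ + d < 2 ^ w)
    (hw₂ : f₂ + d < 2 ^ w) (hwo : out + d < 2 ^ w)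
    (hmatch : xs.filter (· ∈ A') = A.filter (· ∈ A'))
    (hlen : (weave A A' xs A).length = d) :
    Tot w weaveProg s (50 * d + 50) fun s' =>
      Holds s'.mem out (weave A A' xs A) ∧
      (∀ b, b < out ∨ out + d ≤ b → s'.mem b = s.mem b) ∧
      ∀ r, ¬ IsScratch r → s'.reg r = s.reg r := by
  set y := weave A A' xs A with hy
  have hrd : ∀ {s' : Store} {a : ℕ} {o : List (Fin d)}, WeaveInv s out a o s' →
      s'.reg 0 = d ∧ s'.reg 8 = src ∧ s'.reg 17 = lsb ∧ s'.reg 19 = f₁ ∧ s'.reg 20 = f₂ ∧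
        s'.reg 21 = A.length ∧ Holds s'.mem lsb A := by
    intro s' a o h
    refine ⟨?_, ?_, ?_, ?_, ?_, ?_, hA.congr fun b h1 h2 => h.mem b (by omega)⟩
    all_goals rw [h.reg _ (by norm_num [IsScratch])]; assumption
  have hloop₂ : ∀ (n : ℕ) (s' : Store), (∃ a o, n = A.length - a ∧ a ≤ A.length ∧
      WeaveInv s out a o s' ∧ o ++ A.drop a = y) →
      Tot w (.while (.lt (.reg 6) (.reg 21)) copyProg) s' (n * (5 + 1) + 1) fun s' =>
        Holds s'.mem out y ∧ (∀ b, b < out ∨ out + d ≤ b → s'.mem b = s.mem b) ∧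
        ∀ r, ¬ IsScratch r → s'.reg r = s.reg r := by
    refine tot_while _ ?_
    rintro n s' ⟨a, o, hn, ha, hinv, hoy⟩
    obtain ⟨g0, g8, g17, g19, g20, g21, gA⟩ := hrd hinv
    rcases ha.lt_or_eq with hlt | rfl
    · right
      rw [List.drop_eq_getElem_cons hlt] at hoy
      have hol := congrArg List.length hoy
      rw [List.length_append, List.length_cons, hlen] at hol
      refine ⟨by simp [Expr.eval, hinv.used, g21, hlt], ?_⟩
      refine tot_copyProg (t := 0) hinv g17 gA hlt (by omega) hAd hwo hwl fun s'' h'' _ => ?_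
      exact ⟨A.length - (a + 1), by omega, a + 1, _, rfl, hlt, h'', by simpa using hoy⟩
    · left
      refine ⟨by simp [Expr.eval, hinv.used, g21], ?_, hinv.mem, hinv.reg⟩
      rw [List.drop_length, List.append_nil] at hoy
      exact hoy ▸ hinv.holds
  have hloop₁ : ∀ (n : ℕ) (s' : Store), (∃ i a o, n = (d - i) + (A.length - a) ∧ i ≤ d ∧
      a ≤ A.length ∧ s'.reg 4 = i ∧ WeaveInv s out a o s' ∧
      (xs.drop i).filter (· ∈ A') = (A.drop a).filter (· ∈ A') ∧
      o ++ weave A A' (xs.drop i) (A.drop a) = y) →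
      Tot w (.while (.lt (.reg 4) (.reg 0))
        (.seq (.assign 7 (.load (.add (.reg 8) (.reg 4))))
          (.ite (.load (.add (.reg 19) (.reg 7)))
            (.ite (.load (.add (.reg 20) (.reg 7)))
              (.seq (.assign 23 (.eq (.load (.add (.reg 17) (.reg 6))) (.reg 7)))
                (.seq (.assign 4 (.add (.reg 4) (.reg 23))) copyProg))
              (.assign 4 (.add (.reg 4) (.lit 1))))
            (.seq (.store (.reg 13) (.reg 7))
              (.seq (.assign 13 (.add (.reg 13) (.lit 1)))
                (.assign 4 (.add (.reg 4) (.lit 1)))))))) s' (n * (14 + 1) + 1) fun s' =>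
        ∃ a o, a ≤ A.length ∧ WeaveInv s out a o s' ∧ o ++ A.drop a = y := by
    refine tot_while _ ?_
    rintro n s' ⟨i, a, o, hn, hi, ha, h4, hinv, hf, hoy⟩
    obtain ⟨g0, g8, g17, g19, g20, g21, gA⟩ := hrd hinv
    rcases hi.lt_or_eq with hlt | rfl
    · right
      have hlt' : i < xs.length := by omega
      refine ⟨by simp [Expr.eval, h4, g0, hlt], ?_⟩
      set v := xs[i] with hv
      have hvd := v.isLt
      have ev : (Expr.load (.add (.reg 8) (.reg 4))).eval w s' = v := by
        rw [eval_load (eval_add (eval_reg g8) (eval_reg h4) (by omega)),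
          hinv.mem _ (by omega), hxs i hlt']
      rw [List.drop_eq_getElem_cons hlt', ← hv] at hoy hf
      have hol := congrArg List.length hoy
      rw [List.length_append, hlen] at hol
      refine tot_assign_seq ?_
      rw [ev]
      have hinv₂ : WeaveInv s out a o (s'.setReg 7 v) := by
        refine ⟨hinv.holds, ?_, ?_, hinv.mem, ?_⟩
        · simp [Store.reg_setReg, hinv.ptr]
        · simp [Store.reg_setReg, hinv.used]
        · intro r hr
          rw [Store.reg_setReg, if_neg (fun h => hr (by simp [IsScratch, h])), hinv.reg r hr]
      have h4₂ : (s'.setReg 7 v).reg 4 = i := by simp [Store.reg_setReg, h4]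
      have h7₂ : (s'.setReg 7 v).reg 7 = v := by simp [Store.reg_setReg]
      generalize s'.setReg 7 v = s₂ at hinv₂ h4₂ h7₂ ⊢
      clear hinv h4 ev g0 g8 g17 g19 g20 g21 gA s'
      obtain ⟨g0, g8, g17, g19, g20, g21, gA⟩ := hrd hinv₂
      have ev1 : (Expr.load (.add (.reg 19) (.reg 7))).eval w s₂ ≠ 0 ↔ v ∈ A := by
        rw [eval_load (eval_add (eval_reg g19) (eval_reg h7₂) (by omega)),
          hinv₂.mem _ (by omega), hf₁]
      have ev2 : (Expr.load (.add (.reg 20) (.reg 7))).eval w s₂ ≠ 0 ↔ v ∈ A' := by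
        rw [eval_load (eval_add (eval_reg g20) (eval_reg h7₂) (by omega)),
          hinv₂.mem _ (by omega), hf₂]
      refine tot_ite (fun hne => tot_ite (fun hne' => ?_) fun heq' => ?_) fun heq => ?_
      · have hvA := ev1.1 hne
        have hvA' := ev2.1 hne'
        rw [List.filter_cons_of_pos (by simpa using hvA')] at hf
        rcases ha.lt_or_eq with halt | rfl
        swap
        · rw [List.drop_length] at hf
          simp at hf
        rw [List.drop_eq_getElem_cons halt] at hoy hf hol
        rw [weave_cons_cons hvA hvA'] at hoy hol
        rw [List.length_cons] at hol
        set b : ℕ := if A[a] = v then 1 else 0 with hb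
        have hb1 : b ≤ 1 := by rw [hb]; split_ifs <;> omega
        have ev23 : (Expr.eq (.load (.add (.reg 17) (.reg 6))) (.reg 7)).eval w s₂ = b := by
          rw [eval_eq (eval_load (eval_add (eval_reg g17) (eval_reg hinv₂.used) (by omega)))
            (eval_reg h7₂), gA a halt, hb]
          simp only [Fin.ext_iff]
        refine tot_assign_seq ?_
        rw [ev23]
        refine tot_assign_seq ?_
        rw [eval_add (x := i) (y := b)
          (eval_reg (by rw [Store.reg_setReg, if_neg (by norm_num), h4₂]))
          (eval_reg (by rw [Store.reg_setReg, if_pos rfl])) (by omega)]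
        have hinv₃ : WeaveInv s out a o ((s₂.setReg 23 b).setReg 4 (i + b)) := by
          refine ⟨hinv₂.holds, ?_, ?_, hinv₂.mem, ?_⟩
          · simp [Store.reg_setReg, hinv₂.ptr]
          · simp [Store.reg_setReg, hinv₂.used]
          · intro r hr
            rw [Store.reg_setReg, if_neg (fun h => hr (by simp [IsScratch, h])),
              Store.reg_setReg, if_neg (fun h => hr (by simp [IsScratch, h])), hinv₂.reg r hr]
        refine tot_copyProg hinv₃ (by simp [Store.reg_setReg, g17]) gA halt (by omega) hAd hwo hwl
          fun s'' h'' h4'' => ?_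
        refine ⟨(d - (i + b)) + (A.length - (a + 1)), by omega, i + b, a + 1, _, rfl, by omega,
          halt, ?_, h'', ?_, ?_⟩
        · rw [h4'']
          simp [Store.reg_setReg]
        · by_cases hab : A[a] = v
          · simp only [hb, hab, if_true]
            rw [hab, List.filter_cons_of_pos (by simpa using hvA'), List.cons.injEq] at hf
            exact hf.2
          · simp only [hb, hab, if_false, add_zero]
            rw [List.drop_eq_getElem_cons hlt', ← hv,
              List.filter_cons_of_pos (by simpa using hvA'), hf]
            rw [List.filter_cons_of_neg]
            intro hmem
            rw [List.filter_cons_of_pos (p := fun x => decide (x ∈ A')) hmem, List.cons.injEq] at hf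
            exact hab hf.1.symm
        · rw [List.append_assoc, List.singleton_append, ← hoy]
          congr 2
          by_cases hab : A[a] = v
          · simp only [hb, hab, if_true]
          · simp only [hb, hab, if_false, add_zero]
            rw [List.drop_eq_getElem_cons hlt']
      · have hvA := ev1.1 hne
        have hvA' : v ∉ A' := fun h => ev2.2 h heq'
        refine tot_assign ?_
        rw [eval_add (eval_reg h4₂) (eval_lit (n := 1) (by omega)) (by omega)]
        rw [List.filter_cons_of_neg (by simpa using hvA')] at hf
        rw [weave_cons_of_mem_of_notMem hvA hvA'] at hoy
        refine ⟨(d - (i + 1)) + (A.length - a), by omega, i + 1, a, o, rfl, hlt, ha, ?_,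
          ⟨hinv₂.holds, ?_, ?_, hinv₂.mem, ?_⟩, hf, hoy⟩
        · simp [Store.reg_setReg]
        · simp [Store.reg_setReg, hinv₂.ptr]
        · simp [Store.reg_setReg, hinv₂.used]
        · intro r hr
          rw [Store.reg_setReg, if_neg (fun h => hr (by simp [IsScratch, h])), hinv₂.reg r hr]
      · have hvA : v ∉ A := fun h => ev1.2 h heq
        have hvA' : v ∉ A' := by
          intro hm
          have h1 : v ∈ v :: xs.drop (i + 1) := List.mem_cons_self
          have h2 : v ∈ (A.drop a).filter (· ∈ A') := by
            rw [← hf]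
            exact List.mem_filter.2 ⟨h1, by simpa using hm⟩
          exact hvA (List.mem_of_mem_drop (List.mem_filter.1 h2).1)
        rw [weave_cons_of_notMem hvA] at hoy hol
        rw [List.length_cons] at hol
        rw [List.filter_cons_of_neg (by simpa using hvA')] at hf
        refine tot_store_seq (tot_assign_seq (tot_assign ?_))
        rw [eval_reg hinv₂.ptr, eval_reg h7₂,
          eval_add (s := s₂.setMem (out + o.length) v) (eval_reg hinv₂.ptr)
            (eval_lit (n := 1) (by omega)) (by omega),
          eval_add (s := (s₂.setMem (out + o.length) v).setReg 13 (out + o.length + 1))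
            (eval_reg (r := 4) (x := i) h4₂) (eval_lit (n := 1) (by omega)) (by omega)]
        refine ⟨(d - (i + 1)) + (A.length - a), by omega, i + 1, a, o ++ [v], rfl, hlt, ha, ?_,
          ⟨?_, ?_, ?_, ?_, ?_⟩, hf, by simpa using hoy⟩
        · simp [Store.reg_setReg]
        · refine hinv₂.holds.concat ?_ ?_
          · simp [Store.mem_setReg, Store.mem_setMem]
          · intro b hb
            rw [Store.mem_setReg, Store.mem_setReg, Store.mem_setMem, if_neg hb]
        · simp [Store.reg_setReg, add_assoc]
        · simp [Store.reg_setReg, Store.reg_setMem, hinv₂.used]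
        · intro b hb
          rw [Store.mem_setReg, Store.mem_setReg, Store.mem_setMem, if_neg (by omega),
            hinv₂.mem b hb]
        · intro r hr
          rw [Store.reg_setReg, if_neg (fun h => hr (by simp [IsScratch, h])),
            Store.reg_setReg, if_neg (fun h => hr (by simp [IsScratch, h])), Store.reg_setMem,
            hinv₂.reg r hr]
    · left
      refine ⟨by simp [Expr.eval, h4, g0], a, o, ha, hinv, ?_⟩
      rwa [List.drop_eq_nil_of_le (by omega), weave_nil] at hoy
  refine Tot.le (tot_assign_seq (tot_assign_seq (tot_seq
    (t₁ := (d + A.length) * (14 + 1) + 1) (t₂ := A.length * (5 + 1) + 1) ?_))) (by omega)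
  refine (hloop₁ _ _ ⟨0, 0, [], by simp, by omega, by omega, ?_, ⟨?_, ?_, ?_, ?_, ?_⟩, ?_, ?_⟩).imp
    ?_
  · simp [Store.reg_setReg, Expr.eval]
  · intro i hi
    simp at hi
  · simp [Store.reg_setReg, h13]
  · simp [Store.reg_setReg, Expr.eval]
  · intro b _
    rfl
  · intro r hr
    rw [Store.reg_setReg, if_neg (fun h => hr (by simp [IsScratch, h])), Store.reg_setReg,
      if_neg (fun h => hr (by simp [IsScratch, h]))]
  · simpa using hmatch
  · simp [hy]
  · rintro s' ⟨a, o, ha, hinv, hoy⟩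
    exact (hloop₂ _ s' ⟨a, o, rfl, ha, hinv, hoy⟩).le (by
      have : (A.length - a) * (5 + 1) ≤ A.length * (5 + 1) := Nat.mul_le_mul_right _ (by omega)
      omega)

end Weaving
end UlamMedian

namespace UlamMedian

/-! ### The whole program -/


section Main

variable {d w : ℕ}

/-- Calls `scatterProg` with the arguments in the registers `a`, `b` and `c`. -/
def callScatter (a b c : ℕ) : Prog :=
  .seq (.assign 1 (.reg a)) (.seq (.assign 2 (.reg b)) (.seq (.assign 3 (.reg c)) scatterProg))

theorem tot_callScatter {s : Store} {l : List (Fin d)} {src dst a b c : ℕ} (hb1 : b ≠ 1)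
    (hc1 : c ≠ 1) (hc2 : c ≠ 2) (h1 : s.reg a = src) (h2 : s.reg b = l.length)
    (h3 : s.reg c = dst) (hl : Holds s.mem src l) (hnd : l.Nodup) (hlen : l.length ≤ d)
    (hzero : ∀ u : Fin d, s.mem (dst + u) = 0)
    (hdisj : src + l.length ≤ dst ∨ dst + d ≤ src) (hw : src + d < 2 ^ w)
    (hw' : dst + d < 2 ^ w) :
    Tot w (callScatter a b c) s (10 * d + 20) fun s' =>
      (∀ u : Fin d, s'.mem (dst + u) = if u ∈ l then l.idxOf u + 1 else 0) ∧
      (∀ a, a < dst ∨ dst + d ≤ a → s'.mem a = s.mem a) ∧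
      ∀ r, r = 0 ∨ 8 ≤ r → s'.reg r = s.reg r := by
  refine Tot.le (tot_assign_seq (tot_assign_seq (tot_assign_seq (Tot.imp (tot_scatterProg
    (l := l) (src := src) (dst := dst) ?_ ?_ ?_ hl hnd hlen hdisj hw hw') ?_)))) (by omega)
  · simp [Store.reg_setReg, Expr.eval, h1]
  · simp [Store.reg_setReg, Expr.eval, hb1, h2]
  · simp [Store.reg_setReg, Expr.eval, hc1, hc2, h3]
  · rintro s' ⟨hm, hfr, hr⟩
    refine ⟨fun u => ?_, hfr, fun r hr' => ?_⟩
    · rw [hm u]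
      simp only [Store.mem_setReg, hzero]
    · rw [hr r (by omega)]
      simp only [Store.reg_setReg]
      rw [if_neg (by omega), if_neg (by omega), if_neg (by omega)]

/-- Calls `stackProg` with the arguments in the registers `a`, `b`, `c` and `e`, and saves the
length of the result in register `n`. -/
def callStack (a b c e n : ℕ) : Prog :=
  .seq (.assign 1 (.reg a)) (.seq (.assign 2 (.reg b)) (.seq (.assign 3 (.reg c))
    (.seq (.assign 5 (.reg e)) (.seq stackProg (.assign n (.reg 6))))))

theorem tot_callStack {s : Store} {l : List (Fin d)} {q : Fin d → ℕ} {src key dst a b c e n : ℕ}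
    (hb : b ≠ 1) (hc : 8 ≤ c) (he : 8 ≤ e)
    (h1 : s.reg a = src) (h2 : s.reg b = l.length) (h3 : s.reg c = key) (h5 : s.reg e = dst)
    (hl : Holds s.mem src l) (hlen : l.length ≤ d) (hq : ∀ u : Fin d, s.mem (key + u) = q u + 1)
    (hdisj : src + l.length ≤ dst ∨ dst + d ≤ src) (hdisj' : key + d ≤ dst ∨ dst + d ≤ key)
    (hw : src + d < 2 ^ w) (hw' : dst + d < 2 ^ w) (hw'' : key + d < 2 ^ w) :
    Tot w (callStack a b c e n) s (20 * d + 40) fun s' =>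
      s'.reg n = (stackRun q l).length ∧ Holds s'.mem dst (stackRun q l).reverse ∧
      (∀ a, a < dst ∨ dst + d ≤ a → s'.mem a = s.mem a) ∧
      ∀ r, r = 0 ∨ 8 ≤ r → r ≠ n → s'.reg r = s.reg r := by
  refine Tot.le (tot_assign_seq (tot_assign_seq (tot_assign_seq (tot_assign_seq
    (tot_seq (t₂ := 1) (Tot.imp (tot_stackProg
    (l := l) (q := q) (src := src) (key := key) (dst := dst) ?_ ?_ ?_ ?_ hl hlen hq hdisj hdisj'
    hw hw' hw'') ?_)))))) (by omega)
  · simp [Store.reg_setReg, Expr.eval, h1]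
  · simp [Store.reg_setReg, Expr.eval, hb, h2]
  · simp [Store.reg_setReg, Expr.eval, show c ≠ 1 by omega, show c ≠ 2 by omega, h3]
  · simp [Store.reg_setReg, Expr.eval, show e ≠ 1 by omega, show e ≠ 2 by omega,
      show e ≠ 3 by omega, h5]
  · rintro s' ⟨h6, hst, hfr, hr⟩
    refine tot_assign (t := 0) ⟨?_, hst, hfr, fun r hr' hn => ?_⟩
    · simp [Store.reg_setReg, Expr.eval, h6]
    · rw [Store.reg_setReg, if_neg hn, hr r (by omega) (by omega) (by omega)]
      simp only [Store.reg_setReg]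
      rw [if_neg (by omega), if_neg (by omega), if_neg (by omega), if_neg (by omega)]

/-- Computes the addresses of the output and of the work arrays, which follow the input. -/
def layoutProg (η : ℕ) : Prog :=
  .seq (.assign 8 (.add (.reg 0) (.reg 0))) (.seq (.assign 14 (.mul (.lit η) (.reg 0)))
    (.seq (.assign 13 (.reg 14)) (.seq (.assign 15 (.add (.reg 14) (.reg 0)))
      (.seq (.assign 16 (.add (.reg 15) (.reg 0))) (.seq (.assign 17 (.add (.reg 16) (.reg 0)))
        (.seq (.assign 18 (.add (.reg 17) (.reg 0))) (.seq (.assign 19 (.add (.reg 18) (.reg 0)))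
          (.assign 20 (.add (.reg 19) (.reg 0))))))))))

/-- The values of the registers after `layoutProg`, when the output stands at the address `b`. -/
structure Layout (d b : ℕ) (s : Store) : Prop where
  reg0 : s.reg 0 = d
  reg8 : s.reg 8 = d + d
  reg13 : s.reg 13 = b
  reg15 : s.reg 15 = b + d
  reg16 : s.reg 16 = b + d + d
  reg17 : s.reg 17 = b + d + d + d
  reg18 : s.reg 18 = b + d + d + d + d
  reg19 : s.reg 19 = b + d + d + d + d + d
  reg20 : s.reg 20 = b + d + d + d + d + d + d
  reg24 : s.reg 24 = 0

theorem Layout.of_reg_eq {b n : ℕ} {s s' : Store} (h : Layout d b s) (hn : n = 21 ∨ n = 22)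
    (hr : ∀ r, r = 0 ∨ 8 ≤ r → r ≠ n → s'.reg r = s.reg r) : Layout d b s' := by
  obtain ⟨h0, h8, h13, h15, h16, h17, h18, h19, h20, h24⟩ := h
  constructor <;> rw [hr _ (by norm_num) (by omega)] <;> assumption

theorem tot_layoutProg {η : ℕ} {s : Store} (h0 : s.reg 0 = d) (h24 : s.reg 24 = 0)
    (hw : η * d + 8 * d + η + 2 < 2 ^ w) :
    Tot w (layoutProg η) s 20 fun s' => Layout d (η * d) s' ∧ s'.mem = s.mem := by
  have hη : η % 2 ^ w = η := Nat.mod_eq_of_lt (by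
    have := Nat.zero_le (η * d); omega)
  generalize hE : η * d = E at *
  have m0 : (d + d) % 2 ^ w = d + d := Nat.mod_eq_of_lt (by omega)
  have m1 : E % 2 ^ w = E := Nat.mod_eq_of_lt (by omega)
  have m2 : (E + d) % 2 ^ w = E + d := Nat.mod_eq_of_lt (by omega)
  have m3 : (E + d + d) % 2 ^ w = E + d + d := Nat.mod_eq_of_lt (by omega)
  have m4 : (E + d + d + d) % 2 ^ w = E + d + d + d := Nat.mod_eq_of_lt (by omega)
  have m5 : (E + d + d + d + d) % 2 ^ w = E + d + d + d + d := Nat.mod_eq_of_lt (by omega)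
  have m6 : (E + d + d + d + d + d) % 2 ^ w = E + d + d + d + d + d :=
    Nat.mod_eq_of_lt (by omega)
  have m7 : (E + d + d + d + d + d + d) % 2 ^ w = E + d + d + d + d + d + d :=
    Nat.mod_eq_of_lt (by omega)
  iterate 8 refine tot_assign_seq ?_
  refine tot_assign (t := 3) ⟨?_, rfl⟩
  constructor <;> simp [Store.reg_setReg, Expr.eval, h0, h24, hη, hE, m0, m1, m2, m3, m4, m5,
    m6, m7]

/-- The whole algorithm: it appends the candidate computed from the first three samples to the
samples, and outputs all of them. The subroutines work in the registers `1` to `7`, so that the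
addresses computed by `layoutProg` persist, and registers `21` and `22` hold the lengths of the
two stacks. Register `24` is never written and serves as the address `0` of the first sample. -/
def mainProg (η : ℕ) : Prog :=
  .seq (layoutProg η) (.seq (callScatter 0 0 15) (.seq (callScatter 8 0 16)
    (.seq (callStack 24 0 15 17 21) (.seq (callStack 17 21 16 18 22)
      (.seq (callScatter 17 21 19) (.seq (callScatter 18 22 20)
        (.seq weaveProg (.seq (.assign 0 (.lit (η + 1))) (.assign 1 (.lit 0))))))))))

theorem idxOf_word (x : Equiv.Perm (Fin d)) (u : Fin d) : (word x).idxOf u = rank x u := by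
  have hi : rank x u < (word x).length := by
    rw [length_word]
    exact (x.symm u).isLt
  have h : (word x)[rank x u] = u := by simp [word, rank]
  conv_lhs => rw [← h]
  exact (nodup_word x).idxOf_getElem _ _

theorem length_candidateWord (x₁ x₂ x₃ : Equiv.Perm (Fin d)) :
    (candidateWord x₁ x₂ x₃).length = d := by
  rw [← word_candidate, length_word]

theorem length_le_of_nodup {l : List (Fin d)} (h : l.Nodup) : l.length ≤ d := by
  simpa using h.length_le_card

theorem tot_mainProg {η : ℕ} {s : Store} {x₁ x₂ x₃ : Equiv.Perm (Fin d)} (hη : 3 ≤ η)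
    (h0 : s.reg 0 = d) (h24 : s.reg 24 = 0) (hx₁ : Holds s.mem 0 (word x₁))
    (hx₂ : Holds s.mem d (word x₂)) (hx₃ : Holds s.mem (d + d) (word x₃))
    (hzero : ∀ a, η * d ≤ a → s.mem a = 0) (hw : η * d + 8 * d + η + 2 < 2 ^ w) :
    Tot w (mainProg η) s (200 * d + 400) fun s' =>
      s'.reg 0 = η + 1 ∧ s'.reg 1 = 0 ∧ (∀ a, a < η * d → s'.mem a = s.mem a) ∧
        Holds s'.mem (η * d) (word (candidate x₁ x₂ x₃)) := by
  have hE3 : 3 * d ≤ η * d := Nat.mul_le_mul_right d hη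
  have hF := firstKept_spec x₁ x₂
  have hF' := secondKept_spec x₁ x₂ x₃
  have hnF := nodup_of_pairwise_lt hF.1
  have hnF' := nodup_of_pairwise_lt hF'.1
  have hlF := length_le_of_nodup hnF
  have hlF' := length_le_of_nodup hnF'
  have hlw := fun x : Equiv.Perm (Fin d) => length_word x
  rw [word_candidate]
  refine Tot.le (tot_seq ((tot_layoutProg h0 h24 hw).imp ?_))
    (t₁ := 20 + (10 * d + 20 + (10 * d + 20 + (20 * d + 40 + (20 * d + 40 + (10 * d + 20 +
      (10 * d + 20 + (50 * d + 50 + 3 + 1) + 1) + 1) + 1) + 1) + 1) + 1) + 1) (by omega)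
  generalize hE : η * d = E at *
  rintro s₁ ⟨hL, hm⟩
  -- the positions of the symbols in the second and in the third sample
  refine tot_seq ((tot_callScatter (l := word x₂) (src := d) (dst := E + d) (by norm_num)
    (by norm_num) (by norm_num) hL.reg0 (by rw [hL.reg0, hlw]) hL.reg15 (by rwa [hm])
    (nodup_word _) (hlw _).le (fun u => by rw [hm, hzero _ (by omega)])
    (by rw [hlw]; omega) (by omega) (by omega)).imp ?_)
  rintro s₂ ⟨k₂, fr₂, rr₂⟩
  replace hL := hL.of_reg_eq (Or.inl rfl) fun r hr _ => rr₂ r hr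
  have z₂ : ∀ a, E + d + d ≤ a → s₂.mem a = 0 := fun a ha => by
    rw [fr₂ a (by omega), hm, hzero a (by omega)]
  have low₂ : ∀ a, a < E → s₂.mem a = s.mem a := fun a ha => by rw [fr₂ a (by omega), hm]
  refine tot_seq ((tot_callScatter (l := word x₃) (src := d + d) (dst := E + d + d) (by norm_num)
    (by norm_num) (by norm_num) hL.reg8 (by rw [hL.reg0, hlw]) hL.reg16
    (hx₃.congr fun a _ ha => low₂ a (by rw [hlw] at ha; omega))
    (nodup_word _) (hlw _).le (fun u => z₂ _ (by omega))
    (by rw [hlw]; omega) (by omega) (by omega)).imp ?_)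
  rintro s₃ ⟨k₃, fr₃, rr₃⟩
  replace hL := hL.of_reg_eq (Or.inl rfl) fun r hr _ => rr₃ r hr
  have z₃ : ∀ a, E + d + d + d ≤ a → s₃.mem a = 0 := fun a ha => by
    rw [fr₃ a (by omega), z₂ a (by omega)]
  have low₃ : ∀ a, a < E → s₃.mem a = s.mem a := fun a ha => by
    rw [fr₃ a (by omega), low₂ a ha]
  have q₂ : ∀ u : Fin d, s₃.mem (E + d + u) = rank x₂ u + 1 := fun u => by
    have := u.isLt
    rw [fr₃ _ (by omega), k₂, if_pos (mem_word _ _), idxOf_word]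
  have q₃ : ∀ u : Fin d, s₃.mem (E + d + d + u) = rank x₃ u + 1 := fun u => by
    rw [k₃, if_pos (mem_word _ _), idxOf_word]
  clear fr₂ fr₃ k₂ k₃ rr₂ rr₃ z₂ low₂
  -- the two rounds of the removal of inversions
  refine tot_seq ((tot_callStack (l := word x₁) (src := 0) (key := E + d)
    (dst := E + d + d + d) (by norm_num) (by norm_num) (by norm_num) hL.reg24
    (by rw [hL.reg0, hlw]) hL.reg15 hL.reg17
    (hx₁.congr fun a _ ha => low₃ a (by rw [hlw] at ha; omega)) (hlw _).le q₂
    (by rw [hlw]; omega) (by omega) (by omega) (by omega) (by omega)).imp ?_)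
  rintro s₄ ⟨n₄, st₄, fr₄, rr₄⟩
  replace hL := hL.of_reg_eq (Or.inl rfl) rr₄
  have z₄ : ∀ a, E + d + d + d + d ≤ a → s₄.mem a = 0 := fun a ha => by
    rw [fr₄ a (by omega), z₃ a (by omega)]
  have low₄ : ∀ a, a < E → s₄.mem a = s.mem a := fun a ha => by
    rw [fr₄ a (by omega), low₃ a ha]
  replace q₃ : ∀ u : Fin d, s₄.mem (E + d + d + u) = rank x₃ u + 1 := fun u => by
    have := u.isLt
    rw [fr₄ _ (by omega), q₃]
  change Holds s₄.mem _ (firstKept x₁ x₂) at st₄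
  replace n₄ : s₄.reg 21 = (firstKept x₁ x₂).length := by rw [n₄, firstKept, List.length_reverse]
  clear z₃ low₃ q₂ fr₄ rr₄
  refine tot_seq ((tot_callStack (l := firstKept x₁ x₂) (src := E + d + d + d)
    (key := E + d + d) (dst := E + d + d + d + d) (by norm_num) (by norm_num) (by norm_num)
    hL.reg17 n₄ hL.reg16 hL.reg18 st₄ hlF q₃
    (by omega) (by omega) (by omega) (by omega) (by omega)).imp ?_)
  rintro s₅ ⟨n₅, st₅, fr₅, rr₅⟩
  replace hL := hL.of_reg_eq (Or.inr rfl) rr₅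
  have z₅ : ∀ a, E + d + d + d + d + d ≤ a → s₅.mem a = 0 := fun a ha => by
    rw [fr₅ a (by omega), z₄ a (by omega)]
  have low₅ : ∀ a, a < E → s₅.mem a = s.mem a := fun a ha => by
    rw [fr₅ a (by omega), low₄ a ha]
  change Holds s₅.mem _ (secondKept x₁ x₂ x₃) at st₅
  replace n₅ : s₅.reg 22 = (secondKept x₁ x₂ x₃).length := by
    rw [n₅, secondKept, List.length_reverse]
  replace n₄ : s₅.reg 21 = (firstKept x₁ x₂).length := by
    rw [rr₅ 21 (by norm_num) (by norm_num), n₄]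
  replace st₄ : Holds s₅.mem (E + d + d + d) (firstKept x₁ x₂) :=
    st₄.congr fun a _ ha => fr₅ a (by omega)
  clear z₄ low₄ q₃ fr₅ rr₅
  -- the arrays that mark the kept symbols
  refine tot_seq ((tot_callScatter (l := firstKept x₁ x₂) (src := E + d + d + d)
    (dst := E + d + d + d + d + d) (by norm_num) (by norm_num) (by norm_num) hL.reg17 n₄ hL.reg19
    st₄ hnF hlF (fun u => z₅ _ (by omega)) (by omega) (by omega) (by omega)).imp ?_)
  rintro s₆ ⟨k₆, fr₆, rr₆⟩
  replace hL := hL.of_reg_eq (Or.inl rfl) fun r hr _ => rr₆ r hr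
  have z₆ : ∀ a, E + d + d + d + d + d + d ≤ a → s₆.mem a = 0 := fun a ha => by
    rw [fr₆ a (by omega), z₅ a (by omega)]
  have low₆ : ∀ a, a < E → s₆.mem a = s.mem a := fun a ha => by
    rw [fr₆ a (by omega), low₅ a ha]
  replace n₅ : s₆.reg 22 = (secondKept x₁ x₂ x₃).length := by rw [rr₆ 22 (by norm_num), n₅]
  replace n₄ : s₆.reg 21 = (firstKept x₁ x₂).length := by rw [rr₆ 21 (by norm_num), n₄]
  replace st₄ : Holds s₆.mem (E + d + d + d) (firstKept x₁ x₂) :=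
    st₄.congr fun a _ ha => fr₆ a (by omega)
  replace st₅ : Holds s₆.mem (E + d + d + d + d) (secondKept x₁ x₂ x₃) :=
    st₅.congr fun a _ ha => fr₆ a (by omega)
  clear z₅ low₅ fr₆ rr₆
  refine tot_seq ((tot_callScatter (l := secondKept x₁ x₂ x₃) (src := E + d + d + d + d)
    (dst := E + d + d + d + d + d + d) (by norm_num) (by norm_num) (by norm_num) hL.reg18 n₅
    hL.reg20 st₅ hnF' hlF' (fun u => z₆ _ (by omega)) (by omega) (by omega) (by omega)).imp ?_)
  rintro s₇ ⟨k₇, fr₇, rr₇⟩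
  replace hL := hL.of_reg_eq (Or.inl rfl) fun r hr _ => rr₇ r hr
  have low₇ : ∀ a, a < E → s₇.mem a = s.mem a := fun a ha => by
    rw [fr₇ a (by omega), low₆ a ha]
  replace n₄ : s₇.reg 21 = (firstKept x₁ x₂).length := by rw [rr₇ 21 (by norm_num), n₄]
  replace st₄ : Holds s₇.mem (E + d + d + d) (firstKept x₁ x₂) :=
    st₄.congr fun a _ ha => fr₇ a (by omega)
  refine tot_seq (t₁ := 50 * d + 50) (t₂ := 3) ((tot_weaveProg (xs := word x₃)
    (A := firstKept x₁ x₂)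
    (A' := secondKept x₁ x₂ x₃) hL.reg0 hL.reg8 hL.reg17 hL.reg19 hL.reg20 n₄ hL.reg13
    (hx₃.congr fun a _ ha => low₇ a (by rw [hlw] at ha; omega)) (hlw _) st₄ hlF
    (fun u => ?_) (fun u => ?_) (by omega) (by omega) (by omega) (by omega) (by omega) (by omega)
    (by omega) (by omega) (by omega) (filter_mem_secondKept x₁ x₂ x₃)
    (length_candidateWord x₁ x₂ x₃)).imp ?_)
  · have := u.isLt
    rw [fr₇ _ (by omega), k₆]
    simp
  · rw [k₇]
    simp
  rintro s₈ ⟨hy, fr₈, rr₈⟩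
  refine tot_assign_seq (tot_assign (t := 0) ⟨?_, ?_, fun a ha => ?_, hy⟩)
  · simp only [Store.reg_setReg, Expr.eval]
    rw [if_neg (by norm_num), if_pos trivial, Nat.mod_eq_of_lt (show η + 1 < 2 ^ w by omega)]
  · simp [Store.reg_setReg, Expr.eval]
  · rw [Store.mem_setReg, Store.mem_setReg, fr₈ a (by omega), low₇ a ha]

end Main
end UlamMedian

namespace UlamMedian

/-! ### Good samples and good triples -/


section Averages
open Finset

variable {d : ℕ}

theorem exists_obj_eq_opt (S : Finset (Equiv.Perm (Fin d))) : ∃ x₀, obj S x₀ = opt S :=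
  exists_eq_ciInf_of_finite

theorem AgreeOff.symm {V : Type*} {G I : Finset V} {p q : V → ℕ} (h : AgreeOff G I p q) :
    AgreeOff G I q p := fun u hu v hv hu' hv' => (h u hu v hv hu' hv').symm

theorem AgreeOff.trans {V : Type*} [DecidableEq V] {G I J : Finset V} {p q r : V → ℕ}
    (h : AgreeOff G I p q) (h' : AgreeOff G J q r) : AgreeOff G (I ∪ J) p r := by
  intro u hu v hv hu' hv'
  rw [mem_union, not_or] at hu' hv'
  exact (h u hu v hv hu'.1 hv'.1).trans (h' u hu v hv hu'.2 hv'.2)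

theorem obj_eq_sum_coe (S : Finset (Equiv.Perm (Fin d))) (c : Equiv.Perm (Fin d)) :
    (obj S c : ℝ) = ∑ s : S, (ulamDist s.1 c : ℝ) := by
  rw [obj, Nat.cast_sum, ← Finset.sum_coe_sort S]

variable {S : Finset (Equiv.Perm (Fin d))} {x₀ : Equiv.Perm (Fin d)} {I : S → Finset (Fin d)}

/-- If the sets of the symbols that the elements of `S` move overlap a lot on average, then a
noticeable fraction of the elements of `S` are good centers: a symbol moved by both `s` and `x`
is paid for only once in the distance of `s` and `x`. -/
theorem exists_card_le_of_lt_sum_card_inter {κ M : ℝ} (hκ : 0 < κ) (hκ1 : κ < 1)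
    (hI : ∀ x : S, AgreeOff univ (I x) (rank x₀) (rank x.1)) (hM : ∑ x, (#(I x) : ℝ) = M)
    (h : κ * (#S * M) < ∑ x, ∑ x', (#(I x ∩ I x') : ℝ)) :
    ∃ B : Finset S, (#B : ℝ) ≤ (1 - κ / 4) * #S ∧
      ∀ x ∉ B, (obj S x.1 : ℝ) ≤ (2 - κ / 2) * M := by
  classical
  have hM0 : 0 ≤ M := hM ▸ sum_nonneg fun x _ => Nat.cast_nonneg _
  have hcard : (Fintype.card S : ℝ) = #S := by rw [Fintype.card_coe]
  have hx : ∀ x : S, (obj S x.1 : ℝ) ≤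
      ∑ s : S, ((#(I s) : ℝ) + #(I x) - #(I x ∩ I s)) := fun x => by
    rw [obj_eq_sum_coe]
    refine sum_le_sum fun s _ => ?_
    have h1 := ulamDist_le_card ((hI s).symm.trans (hI x))
    have h2 := card_union_add_card_inter (I s) (I x)
    rw [inter_comm] at h2
    rw [le_sub_iff_add_le]
    exact_mod_cast h2 ▸ Nat.add_le_add_right h1 _
  have hsum : ∑ x : S, (obj S x.1 : ℝ) < (2 - κ) * (#S * M) := by
    refine (sum_le_sum fun x _ => hx x).trans_lt ?_
    simp only [sum_sub_distrib, sum_add_distrib, sum_const, nsmul_eq_mul, card_univ, hM, hcard,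
      ← mul_sum]
    linarith
  have hMpos : 0 < M := by
    rcases hM0.eq_or_lt with h0 | h0
    · rw [← h0, mul_zero, mul_zero] at hsum
      exact absurd hsum (sum_nonneg fun x _ => Nat.cast_nonneg _).not_gt
    · exact h0
  refine ⟨univ.filter fun x : S => (2 - κ / 2) * M < obj S x.1, ?_, fun x hx => ?_⟩
  · set B := univ.filter fun x : S => (2 - κ / 2) * M < obj S x.1 with hB
    have h1 : #B * ((2 - κ / 2) * M) ≤ ∑ x ∈ B, (obj S x.1 : ℝ) := by
      rw [← nsmul_eq_mul]
      exact card_nsmul_le_sum _ _ _ fun x hx => (mem_filter.1 hx).2.le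
    have h2 : ∑ x ∈ B, (obj S x.1 : ℝ) ≤ ∑ x : S, (obj S x.1 : ℝ) :=
      sum_le_sum_of_subset_of_nonneg (subset_univ _) fun _ _ _ => Nat.cast_nonneg _
    have h3 : (#B : ℝ) * (2 - κ / 2) ≤ (2 - κ) * #S :=
      le_of_mul_le_mul_right (by linarith) hMpos
    have hn : (0 : ℝ) ≤ #S := Nat.cast_nonneg _
    have h4 : (2 - κ) * #S ≤ (1 - κ / 4) * #S * (2 - κ / 2) := by
      nlinarith [mul_nonneg (sq_nonneg κ) hn]
    exact le_of_mul_le_mul_right (h3.trans h4) (by linarith)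
  · simpa using hx

/-- If the sets of the symbols that the elements of `S` move overlap little on average, then almost
all triples of elements of `S` have a good candidate center. -/
theorem exists_card_le_of_sum_card_inter_le {M : ℝ} [Nonempty S]
    (hI : ∀ x : S, AgreeOff univ (I x) (rank x₀) (rank x.1)) (hM : ∑ x, (#(I x) : ℝ) = M)
    (h : ∑ x, ∑ x', (#(I x ∩ I x') : ℝ) ≤ 1 / 10 ^ 20 * (#S * M)) :
    ∃ B : Finset (S × S × S), 100 * #B ≤ #S ^ 3 ∧
      ∀ x y z, (x, y, z) ∉ B → (obj S (candidate x.1 y.1 z.1) : ℝ) ≤ 3 / 2 * M := by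
  classical
  have hM0 : 0 ≤ M := hM ▸ sum_nonneg fun x _ => Nat.cast_nonneg _
  have hcard : (Fintype.card S : ℝ) = #S := by rw [Fintype.card_coe]
  have hn : (0 : ℝ) < #S := by rw [← hcard]; exact_mod_cast Fintype.card_pos
  have key := sum_card_finalBad_le (p := fun x : S => rank x.1) (rank_injective x₀)
    (fun x => rank_injective x.1) hM (by rwa [hcard])
    (fun x y => (firstKept x.1 y.1).toFinset) fun x y => card_compl_firstKept_le (hI x) (hI y)
  rw [hcard] at key
  set f : S × S × S → ℝ := fun t => #(finalBad (rank x₀) (rank t.1.1)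
    (firstKept t.1.1 t.2.1.1).toFinset (firstBad (rank x₀) (rank t.1.1) (I t.1) (I t.2.1))
    (I t.2.2)) with hf
  have key' : ∑ t, f t ≤ (#S : ℝ) ^ 2 * M / 200 := by
    rw [Fintype.sum_prod_type]
    simp only [Fintype.sum_prod_type]
    exact key
  have hf0 : ∀ t, 0 ≤ f t := fun t => Nat.cast_nonneg _
  refine ⟨univ.filter fun t => M < 2 * #S * f t, ?_, fun x y z hB => ?_⟩
  · set B := univ.filter fun t => M < 2 * #S * f t with hB
    have hsub : ∑ t ∈ B, f t ≤ ∑ t, f t :=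
      sum_le_sum_of_subset_of_nonneg (subset_univ _) fun _ _ _ => hf0 _
    rcases hM0.eq_or_lt with h0 | h0
    · have hz : ∀ t, f t = 0 := fun t => by
        refine le_antisymm ?_ (hf0 t)
        refine (single_le_sum (fun t _ => hf0 t) (mem_univ t)).trans (key'.trans ?_)
        rw [← h0]
        simp
      have : B = ∅ := by
        rw [hB, filter_eq_empty_iff]
        intro t _
        rw [hz t, ← h0]
        simp
      simp [this]
    · have h1 : #B * M ≤ ∑ t ∈ B, 2 * #S * f t := by
        rw [← nsmul_eq_mul]
        exact card_nsmul_le_sum _ _ _ fun t ht => (mem_filter.1 ht).2.le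
      rw [← mul_sum] at h1
      have h2 : (100 : ℝ) * #B ≤ (#S : ℝ) ^ 3 := by
        refine le_of_mul_le_mul_right ?_ h0
        have := mul_le_mul_of_nonneg_left (hsub.trans key') (by positivity : (0 : ℝ) ≤ 2 * #S)
        nlinarith
      exact_mod_cast h2
  · have hB' : 2 * #S * f (x, y, z) ≤ M := by simpa using hB
    have hJ := agreeOff_candidate (hI x) (hI y) (hI z)
    rw [obj_eq_sum_coe]
    have h1 : ∑ s : S, (ulamDist s.1 (candidate x.1 y.1 z.1) : ℝ) ≤
        ∑ s : S, ((#(I s) : ℝ) + f (x, y, z)) := by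
      refine sum_le_sum fun s _ => ?_
      have := (ulamDist_le_card ((hI s).symm.trans hJ)).trans (card_union_le _ _)
      simp only [hf]
      exact_mod_cast this
    refine h1.trans ?_
    rw [sum_add_distrib, hM, sum_const, nsmul_eq_mul, card_univ, hcard]
    linarith

/-- Either a noticeable fraction of the elements of `S` are good centers, or almost all triples of
elements of `S` have a good candidate center. -/
theorem exists_card_le_obj_le (hS : S.Nonempty) :
    (∃ B : Finset S, (#B : ℝ) ≤ (1 - 1 / 10 ^ 20 / 4) * #S ∧
      ∀ x ∉ B, (obj S x.1 : ℝ) ≤ (2 - 1 / 10 ^ 20 / 2) * opt S) ∨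
    ∃ B : Finset (S × S × S), 100 * #B ≤ #S ^ 3 ∧
      ∀ x y z, (x, y, z) ∉ B →
        (obj S (candidate x.1 y.1 z.1) : ℝ) ≤ (2 - 1 / 10 ^ 20 / 2) * opt S := by
  classical
  have : Nonempty S := hS.to_subtype
  obtain ⟨x₀, hx₀⟩ := exists_obj_eq_opt S
  choose I hcard hI using fun x : S => exists_card_eq_ulamDist x.1 x₀
  have hM : ∑ x, (#(I x) : ℝ) = (opt S : ℝ) := by
    rw [← hx₀, obj_eq_sum_coe]
    simp only [hcard]
  rcases lt_or_ge (1 / 10 ^ 20 * (#S * (opt S : ℝ))) (∑ x, ∑ x', (#(I x ∩ I x') : ℝ)) with h | h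
  · exact Or.inl (exists_card_le_of_lt_sum_card_inter (by norm_num) (by norm_num)
      (fun x => (hI x).symm) hM h)
  · obtain ⟨B, hB, hB'⟩ := exists_card_le_of_sum_card_inter_le (fun x => (hI x).symm) hM h
    refine Or.inr ⟨B, hB, fun x y z hx => (hB' x y z hx).trans ?_⟩
    exact mul_le_mul_of_nonneg_right (by norm_num) (Nat.cast_nonneg _)

end Averages

/-! ### The success probability -/

section Sampling

variable {d : ℕ}

/-- An event that contains all but one percent of the outcomes has probability at least `0.99`. -/
theorem le_toOuterMeasure_uniformOfFintype {α : Type*} [Fintype α] [Nonempty α] (B : Finset α)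
    (hB : 100 * B.card ≤ Fintype.card α) {E : Set α} (hE : ∀ a ∉ B, a ∈ E) :
    (99 / 100 : ENNReal) ≤ (PMF.uniformOfFintype α).toOuterMeasure E := by
  classical
  rw [PMF.toOuterMeasure_uniformOfFintype_apply]
  have hcard : (0 : ENNReal) < Fintype.card α := by exact_mod_cast Fintype.card_pos
  have h1 : Fintype.card α ≤ B.card + Fintype.card E := by
    rw [← Set.toFinset_card, ← Finset.card_univ]
    refine (Finset.card_le_card fun a _ => ?_).trans (Finset.card_union_le _ _)
    by_cases ha : a ∈ B
    · exact Finset.mem_union_left _ ha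
    · exact Finset.mem_union_right _ (Set.mem_toFinset.2 (hE a ha))
  rw [ENNReal.le_div_iff_mul_le (Or.inl hcard.ne') (Or.inl (ENNReal.natCast_ne_top _)),
    ENNReal.div_eq_inv_mul, mul_assoc, ENNReal.inv_mul_le_iff (by norm_num) (by norm_num)]
  have h2 : 99 * Fintype.card α ≤ 100 * Fintype.card E := by omega
  exact_mod_cast h2

theorem card_pi_filter_triple_le {σ : Type*} [Fintype σ] (B : Finset (σ × σ × σ)) (m : ℕ)
    [DecidablePred fun X : Fin (m + 3) → σ => (X 0, X 1, X 2) ∈ B] :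
    (Finset.univ.filter fun X : Fin (m + 3) → σ => (X 0, X 1, X 2) ∈ B).card ≤
      B.card * Fintype.card σ ^ m := by
  have h := Finset.card_le_card_of_injOn
    (s := Finset.univ.filter fun X : Fin (m + 3) → σ => (X 0, X 1, X 2) ∈ B)
    (t := B ×ˢ (Finset.univ : Finset (Fin m → σ)))
    (fun X => ((X 0, X 1, X 2), fun i => X i.succ.succ.succ)) (fun X hX => by simpa using hX)
    (fun X _ Y _ hXY => by
      simp only [Prod.mk.injEq] at hXY
      obtain ⟨⟨h0, h1, h2⟩, h3⟩ := hXY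
      funext i
      refine Fin.cases h0 (fun i => Fin.cases h1 (fun i => Fin.cases h2 (fun i => ?_) i) i) i
      exact congrFun h3 i)
  simpa using h

/-- With probability at least `0.99`, one of the sampled permutations or the candidate computed from
the first three of them is a good center. -/
theorem le_toOuterMeasure_sample (S : Finset (Equiv.Perm (Fin d))) (hS : S.Nonempty) {m : ℕ}
    (hm : 100 * (1 - 1 / 10 ^ 20 / 4 : ℝ) ^ (m + 3) ≤ 1)
    {E : Set (Fin (m + 3) → Equiv.Perm (Fin d))}
    (hE : ∀ X, (∃ x ∈ List.ofFn X ++ [candidate (X 0) (X 1) (X 2)],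
      (obj S x : ℝ) ≤ (2 - 1 / 10 ^ 20 / 2) * opt S) → X ∈ E) :
    (99 / 100 : ENNReal) ≤ (uniformSample S hS (m + 3)).toOuterMeasure E := by
  classical
  have : Nonempty S := hS.to_subtype
  rw [uniformSample, PMF.toOuterMeasure_map_apply]
  have hS' : Fintype.card S = S.card := Fintype.card_coe S
  rcases exists_card_le_obj_le hS with ⟨B, hB, hB'⟩ | ⟨B, hB, hB'⟩
  · refine le_toOuterMeasure_uniformOfFintype (Fintype.piFinset fun _ => B) ?_ fun X hX => ?_
    · rw [Fintype.card_piFinset_const, Fintype.card_fun, Fintype.card_fin, hS']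
      have h1 : (B.card : ℝ) ^ (m + 3) ≤
          (1 - 1 / 10 ^ 20 / 4 : ℝ) ^ (m + 3) * (S.card : ℝ) ^ (m + 3) := by
        rw [← mul_pow]
        exact pow_le_pow_left₀ (Nat.cast_nonneg _) hB _
      have h2 : (100 : ℝ) * (B.card : ℝ) ^ (m + 3) ≤ (S.card : ℝ) ^ (m + 3) := by
        have h3 : (0 : ℝ) ≤ (S.card : ℝ) ^ (m + 3) := by positivity
        calc (100 : ℝ) * (B.card : ℝ) ^ (m + 3)
            ≤ 100 * ((1 - 1 / 10 ^ 20 / 4 : ℝ) ^ (m + 3) * (S.card : ℝ) ^ (m + 3)) :=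
              mul_le_mul_of_nonneg_left h1 (by norm_num)
          _ = 100 * (1 - 1 / 10 ^ 20 / 4 : ℝ) ^ (m + 3) * (S.card : ℝ) ^ (m + 3) := by
              rw [mul_assoc]
          _ ≤ 1 * (S.card : ℝ) ^ (m + 3) := mul_le_mul_of_nonneg_right hm h3
          _ = (S.card : ℝ) ^ (m + 3) := one_mul _
      exact_mod_cast h2
    · obtain ⟨i, hi⟩ : ∃ i, X i ∉ B := by
        simpa [Fintype.mem_piFinset] using hX
      refine hE _ ⟨(X i).1, ?_, hB' _ hi⟩
      exact List.mem_append_left _ (List.mem_ofFn.2 ⟨i, rfl⟩)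
  · refine le_toOuterMeasure_uniformOfFintype
      (Finset.univ.filter fun X : Fin (m + 3) → S => (X 0, X 1, X 2) ∈ B) ?_ fun X hX => ?_
    · have h1 := card_pi_filter_triple_le B m
      rw [hS'] at h1
      rw [Fintype.card_fun, Fintype.card_fin, hS']
      calc _ ≤ 100 * (B.card * S.card ^ m) := Nat.mul_le_mul_left _ h1
        _ = 100 * B.card * S.card ^ m := by ring
        _ ≤ S.card ^ 3 * S.card ^ m := Nat.mul_le_mul_right _ hB
        _ = S.card ^ (m + 3) := by ring
    · refine hE _ ⟨_, List.mem_append_right _ (List.mem_singleton_self _), hB' _ _ _ ?_⟩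
      simpa using hX

end Sampling

/-! ### The run of the program -/

section Run

variable {d : ℕ}

theorem inputStore_mem {η : ℕ} (X : Fin η → Equiv.Perm (Fin d)) (i : Fin η) (j : Fin d) :
    (inputStore X).mem (i * d + j) = X i j := by
  have h1 : ((i : ℕ) * d + j) / d = i := by
    rw [mul_comm, Nat.mul_add_div (by have := j.isLt; omega), Nat.div_eq_of_lt j.isLt, add_zero]
  have h2 : ((i : ℕ) * d + j) % d = j := by
    rw [mul_comm, Nat.mul_add_mod, Nat.mod_eq_of_lt j.isLt]
  simp only [inputStore, h1, h2]
  rw [dif_pos ⟨i.isLt, j.isLt⟩]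

theorem inputStore_mem_eq_zero {η : ℕ} (X : Fin η → Equiv.Perm (Fin d)) {a : ℕ} (hd : 0 < d)
    (ha : η * d ≤ a) : (inputStore X).mem a = 0 := by
  simp only [inputStore]
  rw [dif_neg]
  rintro ⟨h, -⟩
  exact absurd h (not_lt.2 ((Nat.le_div_iff_mul_le hd).2 ha))

theorem holds_inputStore {η : ℕ} (X : Fin η → Equiv.Perm (Fin d)) (i : Fin η) :
    Holds (inputStore X).mem (i * d) (word (X i)) := by
  intro j hj
  rw [length_word] at hj
  rw [inputStore_mem X i ⟨j, hj⟩]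
  simp [word]

/-- The word length suffices for all the addresses in use. -/
theorem lt_two_pow_wordLength (η d : ℕ) :
    η * d + 8 * d + η + 2 < 2 ^ wordLength (η + 10) d := by
  have h1 : d < 2 ^ (Nat.log 2 d + 1) := Nat.lt_pow_succ_log_self (by norm_num) d
  have h2 : η + 9 < 2 ^ (η + 9) := Nat.lt_two_pow_self
  have h3 : Nat.log 2 d + 1 + (η + 9) ≤ wordLength (η + 10) d := by
    rw [wordLength]
    nlinarith [Nat.zero_le (η * Nat.log 2 d), Nat.zero_le (Nat.log 2 d)]
  calc η * d + 8 * d + η + 2 < (d + 1) * (η + 10) := by nlinarith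
    _ ≤ 2 ^ (Nat.log 2 d + 1) * 2 ^ (η + 9) := Nat.mul_le_mul h1 h2
    _ = 2 ^ (Nat.log 2 d + 1 + (η + 9)) := (pow_add _ _ _).symm
    _ ≤ _ := Nat.pow_le_pow_right (by norm_num) h3

theorem haltsWith_append_singleton {η : ℕ} {X : Fin η → Equiv.Perm (Fin d)}
    {y : Equiv.Perm (Fin d)} {s : Store} (h0 : s.reg 0 = η + 1) (h1 : s.reg 1 = 0)
    (hX : ∀ (i : Fin η) (j : Fin d), s.mem (i * d + j) = X i j)
    (hy : Holds s.mem (η * d) (word y)) :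
    Config.HaltsWith ⟨[], s⟩ (List.ofFn X ++ [y]) := by
  refine ⟨rfl, by simpa using h0, fun i j => ?_⟩
  have hi : (i : ℕ) < η + 1 := by simpa using i.isLt
  simp only [h1, zero_add, List.get_eq_getElem]
  rcases Nat.lt_succ_iff_lt_or_eq.1 hi with h | h
  · rw [List.getElem_append_left (by simpa using h), List.getElem_ofFn]
    exact hX ⟨i, h⟩ j
  · have := hy j (by rw [length_word]; exact j.isLt)
    rw [List.getElem_append_right (by simp [h])]
    simp only [h, this]
    simp [word]

/-- The program computes, in linear time and without coin tosses, the list of the samples followed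
by the candidate center of the first three of them. -/
theorem runOn_mainProg {m : ℕ} (hd : 1 ≤ d) (X : Fin (m + 3) → Equiv.Perm (Fin d)) :
    ∃ f : Config, runOn (mainProg (m + 3)) (m + 3 + 10) X (200 * d + 400) = PMF.pure f ∧
      f.HaltsWith (List.ofFn X ++ [candidate (X 0) (X 1) (X 2)]) := by
  have hx := holds_inputStore X
  have h := tot_mainProg (w := wordLength (m + 3 + 10) d) (s := inputStore X) (η := m + 3)
    (x₁ := X 0) (x₂ := X 1) (x₃ := X 2)
    (by omega) rfl rfl (by simpa using hx 0) (by simpa using hx 1)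
    (by rw [← two_mul]; exact hx 2)
    (fun a ha => inputStore_mem_eq_zero X hd ha) (lt_two_pow_wordLength _ _)
  obtain ⟨s', ⟨h0, h1, hm, hy⟩, hrun⟩ := h.runSteps_eq
  refine ⟨_, hrun, haltsWith_append_singleton h0 h1 (fun i j => ?_) hy⟩
  rw [hm, inputStore_mem]
  calc (i : ℕ) * d + j < i * d + d := Nat.add_lt_add_left j.isLt _
    _ = (i + 1) * d := by ring
    _ ≤ (m + 3) * d := Nat.mul_le_mul_right _ i.isLt

theorem exists_pow_le : ∃ m : ℕ, 100 * (1 - 1 / 10 ^ 20 / 4 : ℝ) ^ (m + 3) ≤ 1 := by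
  obtain ⟨m, hm⟩ := exists_pow_lt_of_lt_one (show (0 : ℝ) < 1 / 100 by norm_num)
    (show (1 - 1 / 10 ^ 20 / 4 : ℝ) < 1 by norm_num)
  have h := pow_le_pow_of_le_one (show (0 : ℝ) ≤ 1 - 1 / 10 ^ 20 / 4 by norm_num) (by norm_num)
    (Nat.le_add_right m 3)
  exact ⟨m, by linarith⟩

end Run

end UlamMedian

/-- The word-length factor `c`, the program `P` and all other constants are chosen before the number
`d` of symbols and the input set `S`; the program only sees `d` and the sample. -/
theorem mainTheorem2 :
    ∃ (δ : ℝ) (η C c : ℕ) (P : UlamMedian.Prog) (T : ℕ → ℕ),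
      0 < δ ∧ 0 < c ∧
      -- near-linear running time
      (∃ (A : ℝ) (p : ℕ), ∀ d : ℕ, 1 ≤ d → (T d : ℝ) ≤ A * d * (1 + Real.log d) ^ p) ∧
      ∀ d : ℕ, 1 ≤ d →
        -- within `T d` steps, on every input and for all outcomes of the coin tosses, the program
        -- halts with a list of at most `C * η` permutations
        (∀ X : Fin η → Equiv.Perm (Fin d), ∀ f ∈ (UlamMedian.runOn P c X (T d)).support,
          ∃ L : List (Equiv.Perm (Fin d)), f.HaltsWith L ∧ L.length ≤ C * η) ∧
        -- on a random sample from `S`, the list contains a good center with probability `≥ 0.99`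
        ∀ (S : Finset (Equiv.Perm (Fin d))) (hS : S.Nonempty),
          (99 / 100 : ENNReal) ≤
            ((UlamMedian.uniformSample S hS η).bind
              fun X => UlamMedian.runOn P c X (T d)).toOuterMeasure
                {f | ∃ L : List (Equiv.Perm (Fin d)), f.HaltsWith L ∧
                  ∃ x ∈ L, (UlamMedian.obj S x : ℝ) ≤ (2 - δ) * (UlamMedian.opt S : ℝ)} := by
  obtain ⟨m, hm⟩ := UlamMedian.exists_pow_le
  refine ⟨1 / 10 ^ 20 / 2, m + 3, 2, m + 3 + 10, UlamMedian.mainProg (m + 3),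
    fun d => 200 * d + 400, by norm_num, by omega, ⟨600, 0, fun d hd => ?_⟩, fun d hd => ⟨?_, ?_⟩⟩
  · have : (1 : ℝ) ≤ d := by exact_mod_cast hd
    push_cast
    linarith
  · intro X f hf
    obtain ⟨g, hg, hL⟩ := UlamMedian.runOn_mainProg hd X
    rw [hg, PMF.support_pure, Set.mem_singleton_iff] at hf
    refine ⟨_, hf ▸ hL, ?_⟩
    simp only [List.length_append, List.length_ofFn, List.length_singleton]
    omega
  · intro S hS
    choose g hg hL using fun X => UlamMedian.runOn_mainProg (m := m) hd X
    simp only [hg]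
    rw [show (fun X => PMF.pure (g X)) = PMF.pure ∘ g from rfl, PMF.bind_pure_comp,
      PMF.toOuterMeasure_map_apply]
    exact UlamMedian.le_toOuterMeasure_sample S hS hm fun X hX => ⟨_, hL X, hX⟩
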